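/- Let $n\ge m$ be powers of $2$. A perfectly balanced binary hierarchical clustering $\mathcal C$ of $[n]$ with minimum cluster size $m$ is a collection of subsets of $[n]$ (clusters), each of size at least $m$ and any two of them nested or disjoint, that contains $[n]$ and in which every cluster of size larger than $m$ is partitioned into two clusters of equal size. For $\mu>0$ let $v_{\mathcal C}\in\mathbb R^{n\times n}$ be its similarity matrix, $v_{\mathcal C}(x,y)=\mu\cdot|\{C\in\mathcal C: x,y\in C\}|$: two objects separated at the top split have similarity $\mu$, and the similarity grows by exactly $\mu$ at each further level of the hierarchy, up to and including the clusters of size $m$. Let $\mathcal V=\mathcal V_{n,m,\mu}$ be the family of all $v_{\mathcal C}$, viewed as vectors in $\mathbb R^{d}$, $d=n^2$ (the balanced constant block model). In the isotropic setting the observation under $\mathcal C$ is $y\sim\mathbb P_{\mathcal C}=\mathcal N(v_{\mathcal C},I_d)$, and the minimax risk is $\mathcal R(\mathcal V)=\inf_T\sup_{\mathcal C}\mathbb P_{\mathcal C}[T(y)\neq\mathcal C]$, the infimum being over measurable maps $T$ from $\mathbb R^d$ to the set of clusterings. In the experimental design setting with budget $\tau>0$ one also chooses $B\in\mathbb R_+^d$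 with $\|B\|_1\le\tau$; the coordinates of $y$ are independent, $y(i)\sim\mathcal N(v_{\mathcal C}(i),B(i)^{-1})$ if $B(i)>0$ and $y(i)=0$ almost surely if $B(i)=0$; call this law $\mathbb P_{\mathcal C,B}$ and let $\mathcal R(\mathcal V,\tau)=\inf_{T,\,B:\|B\|_1\le\tau}\sup_{\mathcal C}\mathbb P_{\mathcal C,B}[T(y)\ne\mathcal C]$. (1) There is a universal constant $c>0$ such that the following holds for all sequences $n_k,m_k$ of powers of $2$ with $m_k<n_k$ and $n_k>2$, and all $\mu_k>0$. If $\mu_k=o\left(\sqrt{\log(n_km_k)/m_k}\right)$ as $k\to\infty$, then $\mathcal R(\mathcal V_{n_k,m_k,\mu_k})\ge c$ for all large $k$. If $\tau_k>0$ and $\mu_k=o\left(\sqrt{n_k^2\log(n_km_k)/(m_k\tau_k)}\right)$, then $\mathcal R(\mathcal V_{n_k,m_k,\mu_k},\tau_k)\ge c$ for all large $k$. (2) For all powers of two $m\le n$ and all $\mu>0$, in the isotropic setting a maximum likelihood estimator $T_{\mathrm{MLE}}(y)\in\arg\max_{\mathcal C}\mathbb P_{\mathcal C}(y)$, where $\mathbb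 P_{\mathcal C}(y)$ denotes the density, exists, and every such measurable estimator (ties broken arbitrarily) is exactly minimax optimal: $\sup_{\mathcal C}\mathbb P_{\mathcal C}[T_{\mathrm{MLE}}(y)\ne\mathcal C]=\mathcal R(\mathcal V_{n,m,\mu})$. -/

import Mathlib

open MeasureTheory ProbabilityTheory Filter Asymptotics
open scoped NNReal ENNReal

noncomputable section

/-! ### Structured normal means

A family `v : J → ι → ℝ` of mean vectors with coordinates indexed by `ι`, the hypotheses being
indexed by `J`. -/

namespace NormalMeans

variable {ι J : Type*} [Fintype ι]

/-- The law `N(v_j, I)` of the observation under hypothesis `j`: independent coordinates, the `i`-th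
one being `N(v_j(i), 1)`. -/
def isotropicLaw (v : J → ι → ℝ) (j : J) : Measure (ι → ℝ) :=
  Measure.pi fun i => gaussianReal (v j i) 1

/-- The law of the observation under hypothesis `j` and sensing strategy `B`: independent
coordinates, the `i`-th one being `N(v_j(i), 1 / B(i))` if `B(i) > 0`, and almost surely `0` if
`B(i) = 0`. -/
def designLaw (v : J → ι → ℝ) (B : ι → ℝ≥0) (j : J) : Measure (ι → ℝ) :=
  Measure.pi fun i => if B i = 0 then Measure.dirac 0 else gaussianReal (v j i) (B i)⁻¹

/-- An estimator is a measurable map from observations to the (discrete) set of hypotheses. -/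
def IsEstimator (T : (ι → ℝ) → J) : Prop :=
  ∀ s : Set J, MeasurableSet (T ⁻¹' s)

/-- The maximum, over the hypotheses, of the error probability of `T`, when the observation has law
`P j` under hypothesis `j`. -/
def maxRisk (P : J → Measure (ι → ℝ)) (T : (ι → ℝ) → J) : ℝ≥0∞ :=
  ⨆ j, P j {y | T y ≠ j}

/-- The isotropic minimax risk of the family `v`. -/
def minimaxRisk (v : J → ι → ℝ) : ℝ≥0∞ :=
  ⨅ (T : (ι → ℝ) → J) (_ : IsEstimator T), maxRisk (isotropicLaw v) T

/-- The minimax risk of the family `v` under the budget constraint `‖B‖₁ ≤ τ`; the infimum runs over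
the sensing strategy and the estimator. -/
def budgetMinimaxRisk (v : J → ι → ℝ) (τ : ℝ) : ℝ≥0∞ :=
  ⨅ (B : ι → ℝ≥0) (_ : ∑ i, (B i : ℝ) ≤ τ) (T : (ι → ℝ) → J) (_ : IsEstimator T),
    maxRisk (designLaw v B) T

/-- The likelihood of hypothesis `j` at the observation `y` in the isotropic setting. -/
def likelihood (v : J → ι → ℝ) (j : J) (y : ι → ℝ) : ℝ :=
  ∏ i, gaussianPDFReal (v j i) 1 (y i)

/-- `T` is a maximum likelihood estimator (isotropic setting): an estimator which always selects
a hypothesis of maximal likelihood, ties being broken in any measurable way. -/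
def IsMLE (v : J → ι → ℝ) (T : (ι → ℝ) → J) : Prop :=
  IsEstimator T ∧ ∀ y j, likelihood v j y ≤ likelihood v (T y) y

end NormalMeans

/-! ### The balanced constant block model -/

/-- A perfectly balanced binary hierarchical clustering of `n` objects with minimum cluster
size `m`: a laminar collection of clusters of size at least `m` that contains the set of all
objects, and in which every cluster of size larger than `m` is partitioned into two clusters of
equal size. -/
structure BalancedHierarchy (n m : ℕ) where
  /-- the clusters -/
  clusters : Finset (Finset (Fin n))
  univ_mem : Finset.univ ∈ clusters
  le_card : ∀ A ∈ clusters, m ≤ A.card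
  laminar : ∀ A ∈ clusters, ∀ A' ∈ clusters, A ⊆ A' ∨ A' ⊆ A ∨ Disjoint A A'
  split : ∀ A ∈ clusters, m < A.card →
    ∃ L ∈ clusters, ∃ R ∈ clusters, Disjoint L R ∧ L ∪ R = A ∧ L.card = R.card

/-- The similarity matrices of the balanced constant block model, as vectors indexed by the pairs
of objects. The similarity of `x` and `y` is `μ` times the number of clusters containing both:
it is `μ` for objects separated at the top split, it is larger by exactly `μ` at each further level
of the hierarchy, and it is largest inside the clusters of size `m`. -/
def cbmFamily (n m : ℕ) (μ : ℝ) (C : BalancedHierarchy n m) (p : Fin n × Fin n) : ℝ :=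
  μ * ((C.clusters.filter fun A => p.1 ∈ A ∧ p.2 ∈ A).card : ℝ)

end

/-! Lower bounds. It suffices to find many hypotheses close to a single mean vector. In the
hierarchy of dyadic intervals, exchange two objects lying in sibling intervals of length comparable
to m. Only similarities between an exchanged object and the O(m) objects of the enclosing interval
change, each by at most 2μ, so the squared distance is at most 64μ²m; there are n/2 distinct such
exchanges (`exists_swap_family`). A sensing strategy B could concentrate on the affected pairs, but
it is fixed before the hypothesis. Averaged over all renamings of the objects, a given off-diagonal
pair becomes uniform over off-diagonal pairs, so some renaming makes the B-weighted distances
average at most a constant times τμ²m/n² (`exists_perm_sum_le`), and by Markov's inequality three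
quarters of the alternatives are good. A chi-square change of measure (`designLaw_real_le`), summed
over the disjoint decision regions, then bounds the average success probability away from 1. The
isotropic case is B = 1, τ = n². Optimality of maximum likelihood. All hierarchies are renamings of
one another (`exists_relabel_eq`), so the symmetries of the family act transitively on the
hypotheses. Ties are null sets, so the error of a maximum likelihood estimator is the same under
every hypothesis. It also minimizes the average error, being Bayes for the uniform prior; a Bayes
rule of constant risk is minimax. -/

namespace NormalMeans

/-! ### Gaussian densities and the second-moment change of measure -/

section Density

variable {ι : Type*} [Fintype ι] {X : ι → Type*} [∀ i, MeasurableSpace (X i)]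

/-- A product of measures with densities is the product measure with the product density. -/
theorem pi_withDensity_ofReal (μ ν : ∀ i, Measure (X i)) [∀ i, SigmaFinite (μ i)]
    [∀ i, SigmaFinite (ν i)] (f : ∀ i, X i → ℝ) (hf0 : ∀ i x, 0 ≤ f i x)
    (hf : ∀ i, Integrable (f i) (μ i))
    (hν : ∀ i, ν i = (μ i).withDensity fun x => ENNReal.ofReal (f i x)) :
    Measure.pi ν = (Measure.pi μ).withDensity fun y => ENNReal.ofReal (∏ i, f i (y i)) := by
  refine Measure.pi_eq fun s hs => ?_
  rw [withDensity_apply _ (MeasurableSet.univ_pi hs), Measure.restrict_pi_pi,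
    ← ofReal_integral_eq_lintegral_ofReal]
  · rw [integral_fintype_prod_eq_prod, ENNReal.ofReal_prod_of_nonneg]
    · refine Finset.prod_congr rfl fun i _ => ?_
      rw [hν i, withDensity_apply _ (hs i), ofReal_integral_eq_lintegral_ofReal]
      · exact (hf i).restrict
      · exact Filter.Eventually.of_forall (hf0 i)
    · exact fun i _ => integral_nonneg (hf0 i)
  · exact Integrable.fintype_prod_dep fun i => (hf i).restrict
  · exact Filter.Eventually.of_forall fun y => Finset.prod_nonneg fun i _ => hf0 i _

end Density

variable {ι J : Type*} [Fintype ι]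

theorem measurable_likelihood (v : J → ι → ℝ) (j : J) : Measurable (likelihood v j) := by
  unfold likelihood
  exact Finset.measurable_fun_prod _ fun i _ =>
    (measurable_gaussianPDFReal _ _).comp (measurable_pi_apply i)

/-- The likelihood is the Lebesgue density of the law. -/
theorem isotropicLaw_eq_withDensity (v : J → ι → ℝ) (j : J) :
    isotropicLaw v j = volume.withDensity fun y => ENNReal.ofReal (likelihood v j y) :=
  pi_withDensity_ofReal (fun _ => volume) _ (fun i => gaussianPDFReal (v j i) 1)
    (fun _ _ => gaussianPDFReal_nonneg _ _ _) (fun _ => integrable_gaussianPDFReal _ _)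
    (fun _ => gaussianReal_of_var_ne_zero _ one_ne_zero)

theorem isotropicLaw_absolutelyContinuous (v : J → ι → ℝ) (j : J) :
    isotropicLaw v j ≪ volume := by
  rw [isotropicLaw_eq_withDensity]
  exact withDensity_absolutelyContinuous _ _

instance isProbabilityMeasure_isotropicLaw (v : J → ι → ℝ) (j : J) :
    IsProbabilityMeasure (isotropicLaw v j) := by
  unfold isotropicLaw
  infer_instance

theorem isotropicLaw_eq_designLaw (v : J → ι → ℝ) (j : J) :
    isotropicLaw v j = designLaw v 1 j := by
  simp [isotropicLaw, designLaw]

/-- The law of one coordinate in the experimental design setting. -/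
noncomputable def designCoord (b : ℝ≥0) (a : ℝ) : Measure ℝ :=
  if b = 0 then Measure.dirac 0 else gaussianReal a b⁻¹

instance isProbabilityMeasure_designCoord (b : ℝ≥0) (a : ℝ) :
    IsProbabilityMeasure (designCoord b a) := by
  unfold designCoord
  split_ifs <;> infer_instance

instance isProbabilityMeasure_designLaw (v : J → ι → ℝ) (B : ι → ℝ≥0) (j : J) :
    IsProbabilityMeasure (designLaw v B j) :=
  inferInstanceAs (IsProbabilityMeasure (Measure.pi fun i => designCoord (B i) (v j i)))

/-- The likelihood ratio of the means `a` and `a₀` for an observation of precision `b`. -/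
noncomputable def designRatio (b : ℝ≥0) (a₀ a : ℝ) (x : ℝ) : ℝ :=
  Real.exp (b * (a - a₀) * x + -(b * (a ^ 2 - a₀ ^ 2) / 2))

theorem designRatio_pos (b : ℝ≥0) (a₀ a x : ℝ) : 0 < designRatio b a₀ a x := Real.exp_pos _

theorem continuous_designRatio (b : ℝ≥0) (a₀ a : ℝ) : Continuous (designRatio b a₀ a) := by
  unfold designRatio
  fun_prop

theorem designRatio_sq (b : ℝ≥0) (a₀ a x : ℝ) :
    designRatio b a₀ a x ^ 2 =
      Real.exp (2 * b * (a - a₀) * x) * Real.exp (-(b * (a ^ 2 - a₀ ^ 2))) := by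
  rw [designRatio, ← Real.exp_nat_mul, ← Real.exp_add]
  congr 1
  push_cast
  ring

theorem integrable_designRatio (b : ℝ≥0) (a₀ a : ℝ) :
    Integrable (designRatio b a₀ a) (designCoord b a₀) := by
  unfold designCoord
  split_ifs with hb
  · exact integrable_dirac (by simp [enorm_lt_top])
  · unfold designRatio
    simp_rw [Real.exp_add]
    exact (integrable_exp_mul_gaussianReal _).mul_const _

theorem integrable_designRatio_sq (b : ℝ≥0) (a₀ a : ℝ) :
    Integrable (fun x => designRatio b a₀ a x ^ 2) (designCoord b a₀) := by
  unfold designCoord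
  split_ifs with hb
  · exact integrable_dirac (by simp [enorm_lt_top])
  · simp_rw [designRatio_sq]
    exact (integrable_exp_mul_gaussianReal _).mul_const _

/-- This is one plus the chi-square divergence of one coordinate. An unobserved coordinate (b = 0)
has ratio 1 and contributes nothing, so no case distinction survives in the product. -/
theorem integral_designRatio_sq (b : ℝ≥0) (a₀ a : ℝ) :
    ∫ x, designRatio b a₀ a x ^ 2 ∂designCoord b a₀ = Real.exp (b * (a - a₀) ^ 2) := by
  unfold designCoord
  split_ifs with hb
  · simp [designRatio, hb]
  · simp_rw [designRatio_sq]
    have h := congrFun (mgf_id_gaussianReal (μ := a₀) (v := b⁻¹)) (2 * b * (a - a₀))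
    simp only [mgf, id] at h
    rw [integral_mul_const, h, ← Real.exp_add]
    have hb' : (b : ℝ) ≠ 0 := by exact_mod_cast hb
    congr 1
    push_cast
    field_simp
    ring

theorem designCoord_eq_withDensity (b : ℝ≥0) (a₀ a : ℝ) :
    designCoord b a =
      (designCoord b a₀).withDensity fun x => ENNReal.ofReal (designRatio b a₀ a x) := by
  unfold designCoord
  split_ifs with hb
  · simp [designRatio, hb]
  · have hv : b⁻¹ ≠ 0 := inv_ne_zero hb
    have hb' : (b : ℝ) ≠ 0 := by exact_mod_cast hb
    rw [gaussianReal_of_var_ne_zero _ hv, gaussianReal_of_var_ne_zero _ hv,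
      ← withDensity_mul _ (measurable_gaussianPDF _ _)
        (continuous_designRatio b a₀ a).measurable.ennreal_ofReal]
    congr 1
    funext x
    simp only [Pi.mul_apply, gaussianPDF]
    rw [← ENNReal.ofReal_mul (gaussianPDFReal_nonneg _ _ _), gaussianPDFReal_def,
      gaussianPDFReal_def, designRatio]
    beta_reduce
    rw [mul_assoc (√_)⁻¹, ← Real.exp_add]
    congr 3
    push_cast
    field_simp
    ring

/-- Change of measure with second moments: the probability of an event under hypothesis `j` in
terms of its probability under an arbitrary mean vector `w`. -/
theorem designLaw_real_le (v : J → ι → ℝ) (w : ι → ℝ) (B : ι → ℝ≥0) (j : J) {t : ℝ} (ht : 0 < t)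
    {E : Set (ι → ℝ)} (hE : MeasurableSet E) :
    (designLaw v B j).real E ≤
      Real.exp (∑ i, (B i : ℝ) * (v j i - w i) ^ 2) / (2 * t) +
        t / 2 * (designLaw (fun _ : Unit => w) B ()).real E := by
  have hP : designLaw (fun _ : Unit => w) B () = Measure.pi fun i => designCoord (B i) (w i) := rfl
  set P := designLaw (fun _ : Unit => w) B () with hPdef
  set F : (ι → ℝ) → ℝ := fun y => ∏ i, designRatio (B i) (w i) (v j i) (y i) with hF
  have hF0 : ∀ y, 0 ≤ F y := fun y => Finset.prod_nonneg fun i _ => (designRatio_pos _ _ _ _).le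
  have hFi : Integrable F P := by
    rw [hP]
    exact Integrable.fintype_prod_dep fun i => integrable_designRatio _ _ _
  have hF2 : (fun y => F y ^ 2) =
      fun y => ∏ i, (designRatio (B i) (w i) (v j i) (y i)) ^ 2 := by
    funext y
    rw [hF, Finset.prod_pow]
  have hF2i : Integrable (fun y => F y ^ 2) P := by
    rw [hP, hF2]
    exact Integrable.fintype_prod_dep
      (f := fun i x => designRatio (B i) (w i) (v j i) x ^ 2)
      fun i => integrable_designRatio_sq _ _ _
  have hF2v : ∫ y, F y ^ 2 ∂P = Real.exp (∑ i, (B i : ℝ) * (v j i - w i) ^ 2) := by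
    rw [hP, hF2, integral_fintype_prod_eq_prod
      (f := fun i x => designRatio (B i) (w i) (v j i) x ^ 2), Real.exp_sum]
    exact Finset.prod_congr rfl fun i _ => integral_designRatio_sq _ _ _
  have hlaw : designLaw v B j = P.withDensity fun y => ENNReal.ofReal (F y) := by
    rw [hP]
    exact pi_withDensity_ofReal (fun i => designCoord (B i) (w i))
      (fun i => designCoord (B i) (v j i)) _ (fun i x => (designRatio_pos _ _ _ _).le)
      (fun i => integrable_designRatio _ _ _) fun i => designCoord_eq_withDensity _ _ _
  have h1 : (designLaw v B j).real E = ∫ y in E, F y ∂P := by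
    rw [Measure.real, hlaw, withDensity_apply _ hE, integral_eq_lintegral_of_nonneg_ae
      (Filter.Eventually.of_forall hF0) hFi.restrict.aestronglyMeasurable]
  -- AM-GM with a free parameter t, which later balances the second moment against the number of
  -- hypotheses.
  have h2 : ∀ y, F y ≤ F y ^ 2 / (2 * t) + t / 2 := fun y => by
    have : 0 ≤ (F y - t) ^ 2 / (2 * t) := by positivity
    have e : F y ^ 2 / (2 * t) + t / 2 - F y = (F y - t) ^ 2 / (2 * t) := by
      field_simp
      ring
    linarith
  calc (designLaw v B j).real E = ∫ y in E, F y ∂P := h1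
    _ ≤ ∫ y in E, (F y ^ 2 / (2 * t) + t / 2) ∂P :=
        integral_mono hFi.restrict
          ((hF2i.restrict.div_const _).add (integrable_const _)) h2
    _ = (∫ y in E, F y ^ 2 ∂P) / (2 * t) + t / 2 * P.real E := by
        rw [integral_add (hF2i.restrict.div_const _) (integrable_const _), integral_div]
        simp [mul_comm]
    _ ≤ _ := by
        gcongr
        rw [← hF2v]
        exact setIntegral_le_integral hF2i (Filter.Eventually.of_forall fun y => sq_nonneg _)

/-- A lower bound on the maximal risk from finitely many hypotheses close to one mean vector. -/
theorem le_maxRisk_designLaw (v : J → ι → ℝ) (w : ι → ℝ) (B : ι → ℝ≥0) {G : Finset J}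
    (hG : G.Nonempty) {K t r : ℝ} (ht : 0 < t)
    (hK : ∀ j ∈ G, ∑ i, (B i : ℝ) * (v j i - w i) ^ 2 ≤ K)
    (hr : Real.exp K / (2 * t) + t / 2 / G.card ≤ r) {T : (ι → ℝ) → J} (hT : IsEstimator T) :
    ENNReal.ofReal (1 - r) ≤ maxRisk (designLaw v B) T := by
  set P := designLaw (fun _ : Unit => w) B ()
  have hcard : (0 : ℝ) < G.card := by exact_mod_cast hG.card_pos
  -- The decision regions are disjoint, so under the common reference law their probabilities share
  -- a total mass of 1.
  have hsum : ∑ j ∈ G, P.real (T ⁻¹' {j}) ≤ 1 := by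
    rw [← measureReal_biUnion_finset]
    · exact measureReal_le_one
    · intro i _ j _ hij
      exact Disjoint.preimage _ (by simpa using hij)
    · exact fun j _ => hT _
  have hsum' : ∑ j ∈ G, (designLaw v B j).real (T ⁻¹' {j}) ≤ ∑ _j ∈ G, r := by
    calc ∑ j ∈ G, (designLaw v B j).real (T ⁻¹' {j})
        ≤ ∑ j ∈ G, (Real.exp K / (2 * t) + t / 2 * P.real (T ⁻¹' {j})) := by
          refine Finset.sum_le_sum fun j hj => ?_
          refine (designLaw_real_le v w B j ht (hT _)).trans ?_
          gcongr
          exact hK j hj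
      _ = G.card * (Real.exp K / (2 * t)) + t / 2 * ∑ j ∈ G, P.real (T ⁻¹' {j}) := by
          rw [Finset.sum_add_distrib, Finset.mul_sum]
          simp
      _ ≤ G.card * (Real.exp K / (2 * t)) + t / 2 * 1 := by gcongr
      _ = G.card * (Real.exp K / (2 * t) + t / 2 / G.card) := by
          field_simp
      _ ≤ G.card * r := by gcongr
      _ = _ := by simp
  obtain ⟨j, hj, hle⟩ := Finset.exists_le_of_sum_le hG hsum'
  refine le_trans ?_ (le_iSup _ j)
  have hset : {y | T y ≠ j} = (T ⁻¹' {j})ᶜ := by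
    ext y
    simp
  have hcompl := probReal_compl_eq_one_sub (μ := designLaw v B j) (hT {j})
  rw [hset, ← ofReal_measureReal, hcompl]
  exact ENNReal.ofReal_le_ofReal (by linarith)

end NormalMeans

/-! ### Similarities determine the hierarchy; all hierarchies are isomorphic -/

namespace BalancedHierarchy

variable {n m : ℕ}

/-- The number of clusters containing both `x` and `y`. -/
def jointCount (C : BalancedHierarchy n m) (x y : Fin n) : ℕ :=
  (C.clusters.filter fun A => x ∈ A ∧ y ∈ A).card

theorem cbmFamily_apply (μ : ℝ) (C : BalancedHierarchy n m) (p : Fin n × Fin n) :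
    cbmFamily n m μ C p = μ * (C.jointCount p.1 p.2 : ℝ) := rfl

theorem clusters_injective :
    Function.Injective (clusters : BalancedHierarchy n m → Finset (Finset (Fin n))) := by
  rintro ⟨c, _, _, _, _⟩ ⟨c', _, _, _, _⟩ h
  simpa using h

instance : Finite (BalancedHierarchy n m) := Finite.of_injective _ clusters_injective

/-- By laminarity, a cluster meeting both halves of a split and contained in neither must contain
both, so nothing lies strictly between a cluster and its halves. -/
theorem subset_of_subset_union (C : BalancedHierarchy n m) {L R B : Finset (Fin n)}
    (hL : L ∈ C.clusters) (hR : R ∈ C.clusters) (hB : B ∈ C.clusters) (h : B ⊆ L ∪ R) :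
    B = L ∪ R ∨ B ⊆ L ∨ B ⊆ R := by
  rcases C.laminar B hB L hL with h1 | h1 | h1
  · exact Or.inr (Or.inl h1)
  · rcases C.laminar B hB R hR with h2 | h2 | h2
    · exact Or.inr (Or.inr h2)
    · exact Or.inl (h.antisymm (Finset.union_subset h1 h2))
    · exact Or.inr (Or.inl (h2.left_le_of_le_sup_right h))
  · exact Or.inr (Or.inr (h1.left_le_of_le_sup_left h))

/-- Two objects in a cluster `A` that lie in no smaller cluster together. -/
theorem exists_pair_forall_subset (hm : 0 < m) (C : BalancedHierarchy n m) {A : Finset (Fin n)}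
    (hA : A ∈ C.clusters) :
    ∃ x ∈ A, ∃ y ∈ A, ∀ B ∈ C.clusters, x ∈ B → y ∈ B → A ⊆ B := by
  rcases (C.le_card A hA).lt_or_eq with h | h
  · obtain ⟨L, hL, R, hR, hd, rfl, -⟩ := C.split A hA h
    obtain ⟨x, hx⟩ := Finset.card_pos.1 (hm.trans_le (C.le_card L hL))
    obtain ⟨y, hy⟩ := Finset.card_pos.1 (hm.trans_le (C.le_card R hR))
    refine ⟨x, Finset.mem_union_left _ hx, y, Finset.mem_union_right _ hy, fun B hB hxB hyB => ?_⟩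
    rcases C.laminar B hB _ hA with h1 | h1 | h1
    · rcases C.subset_of_subset_union hL hR hB h1 with h2 | h2 | h2
      · exact h2.ge
      · exact (Finset.disjoint_left.1 hd (h2 hyB) hy).elim
      · exact (Finset.disjoint_left.1 hd hx (h2 hxB)).elim
    · exact h1
    · exact (Finset.disjoint_left.1 h1 hxB (Finset.mem_union_left _ hx)).elim
  -- A cluster of minimum size has no split; the pair (x, x) serves, since no smaller cluster
  -- exists.
  · obtain ⟨x, hx⟩ := Finset.card_pos.1 (hm.trans_le (C.le_card A hA))
    refine ⟨x, hx, x, hx, fun B hB hxB _ => ?_⟩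
    rcases C.laminar B hB A hA with h1 | h1 | h1
    · exact (Finset.eq_of_subset_of_card_le h1 (h ▸ C.le_card B hB)).ge
    · exact h1
    · exact (Finset.disjoint_left.1 h1 hxB hx).elim

/-- If `x, y ∈ A` lie in no smaller cluster together, the similarities to `x` determine `A`. -/
theorem eq_filter_jointCount_le (C : BalancedHierarchy n m) {A : Finset (Fin n)}
    (hA : A ∈ C.clusters) {x y : Fin n} (hx : x ∈ A) (hy : y ∈ A)
    (h : ∀ B ∈ C.clusters, x ∈ B → y ∈ B → A ⊆ B) :
    A = Finset.univ.filter fun z => C.jointCount x y ≤ C.jointCount x z := by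
  ext z
  simp only [Finset.mem_filter, Finset.mem_univ, true_and]
  constructor
  · intro hz
    refine Finset.card_le_card fun B hB => ?_
    simp only [Finset.mem_filter] at hB ⊢
    exact ⟨hB.1, hB.2.1, h B hB.1 hB.2.1 hB.2.2 hz⟩
  · intro hz
    by_contra hzA
    refine hz.not_gt (Finset.card_lt_card ?_)
    refine (Finset.ssubset_iff_of_subset fun B hB => ?_).2 ⟨A, ?_, ?_⟩
    · simp only [Finset.mem_filter] at hB ⊢
      refine ⟨hB.1, hB.2.1, ?_⟩
      rcases C.laminar B hB.1 A hA with h1 | h1 | h1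
      · exact (hzA (h1 hB.2.2)).elim
      · exact h1 hy
      · exact (Finset.disjoint_left.1 h1 hB.2.1 hx).elim
    · simp [hA, hx, hy]
    · simp [hzA]

/-- The clusters are exactly the smallest common clusters of pairs, and these can be read off from
the joint counts. This yields injectivity of the family. -/
theorem mem_clusters_iff (hm : 0 < m) (C : BalancedHierarchy n m) (A : Finset (Fin n)) :
    A ∈ C.clusters ↔
      ∃ x y, A = Finset.univ.filter fun z => C.jointCount x y ≤ C.jointCount x z := by
  constructor
  · intro hA
    obtain ⟨x, hx, y, hy, h⟩ := C.exists_pair_forall_subset hm hA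
    exact ⟨x, y, C.eq_filter_jointCount_le hA hx hy h⟩
  · rintro ⟨x, y, rfl⟩
    obtain ⟨A, hA, hmin⟩ := Finset.exists_min_image
      (C.clusters.filter fun A => x ∈ A ∧ y ∈ A) Finset.card
      ⟨Finset.univ, by simp [C.univ_mem]⟩
    rw [Finset.mem_filter] at hA
    rw [← C.eq_filter_jointCount_le hA.1 hA.2.1 hA.2.2]
    · exact hA.1
    · intro B hB hxB hyB
      rcases C.laminar B hB A hA.1 with h1 | h1 | h1
      · exact (Finset.eq_of_subset_of_card_le h1 (hmin B (by simp [hB, hxB, hyB]))).ge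
      · exact h1
      · exact (Finset.disjoint_left.1 h1 hxB hA.2.1).elim

theorem jointCount_injective (hm : 0 < m) :
    Function.Injective (jointCount : BalancedHierarchy n m → Fin n → Fin n → ℕ) := by
  intro C C' h
  refine clusters_injective (Finset.ext fun A => ?_)
  rw [mem_clusters_iff hm, mem_clusters_iff hm, h]

theorem cbmFamily_injective (hm : 0 < m) {μ : ℝ} (hμ : μ ≠ 0) :
    Function.Injective (cbmFamily n m μ) := by
  intro C C' h
  refine jointCount_injective hm (funext fun x => funext fun y => ?_)
  have := congrFun h (x, y)
  simpa [cbmFamily_apply, hμ] using this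

/-- The hierarchy in which the objects are renamed by a permutation. -/
def relabel (C : BalancedHierarchy n m) (σ : Equiv.Perm (Fin n)) : BalancedHierarchy n m where
  clusters := C.clusters.map (Finset.mapEmbedding σ.toEmbedding).toEmbedding
  univ_mem := Finset.mem_map.2 ⟨_, C.univ_mem, Finset.map_univ_equiv σ⟩
  le_card := by
    simp only [Finset.mem_map]
    rintro _ ⟨A, hA, rfl⟩
    simpa using C.le_card A hA
  laminar := by
    simp only [Finset.mem_map]
    rintro _ ⟨A, hA, rfl⟩ _ ⟨B, hB, rfl⟩
    simpa using C.laminar A hA B hB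
  split := by
    simp only [Finset.mem_map]
    rintro _ ⟨A, hA, rfl⟩ h
    obtain ⟨L, hL, R, hR, hd, rfl, hc⟩ := C.split A hA (by simpa using h)
    refine ⟨_, ⟨L, hL, rfl⟩, _, ⟨R, hR, rfl⟩, ?_, ?_, ?_⟩
    · simpa using hd
    · simp [Finset.map_union]
    · simpa using hc

theorem jointCount_relabel (C : BalancedHierarchy n m) (σ : Equiv.Perm (Fin n)) (x y : Fin n) :
    (C.relabel σ).jointCount x y = C.jointCount (σ.symm x) (σ.symm y) := by
  unfold jointCount relabel
  rw [Finset.filter_map, Finset.card_map]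
  congr 1
  ext A
  simp [Finset.mem_map_equiv]

theorem relabel_injective (hm : 0 < m) (σ : Equiv.Perm (Fin n)) :
    Function.Injective fun C : BalancedHierarchy n m => C.relabel σ := by
  intro C C' h
  refine jointCount_injective hm (funext fun x => funext fun y => ?_)
  have := congrArg (fun D : BalancedHierarchy n m => D.jointCount (σ x) (σ y)) h
  simpa [jointCount_relabel] using this

/-- The number of clusters inside `A` containing both `x` and `y`. -/
def jointCountIn (C : BalancedHierarchy n m) (A : Finset (Fin n)) (x y : Fin n) : ℕ :=
  (C.clusters.filter fun B => B ⊆ A ∧ x ∈ B ∧ y ∈ B).card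

theorem jointCountIn_univ (C : BalancedHierarchy n m) (x y : Fin n) :
    C.jointCountIn Finset.univ x y = C.jointCount x y := by
  simp [jointCountIn, jointCount]

theorem jointCountIn_comm (C : BalancedHierarchy n m) (A : Finset (Fin n)) (x y : Fin n) :
    C.jointCountIn A x y = C.jointCountIn A y x := by
  simp only [jointCountIn, and_comm]

theorem jointCountIn_of_card_le (C : BalancedHierarchy n m) {A : Finset (Fin n)}
    (hA : A ∈ C.clusters) (h : A.card ≤ m) {x y : Fin n} (hx : x ∈ A) (hy : y ∈ A) :
    C.jointCountIn A x y = 1 := by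
  refine Finset.card_eq_one.2 ⟨A, ?_⟩
  ext B
  simp only [Finset.mem_filter, Finset.mem_singleton]
  constructor
  · rintro ⟨hB, hBA, -⟩
    exact Finset.eq_of_subset_of_card_le hBA (h.trans (C.le_card B hB))
  · rintro rfl
    exact ⟨hA, subset_rfl, hx, hy⟩

/-- Passing to a half loses only the parent cluster. Positivity of m makes R nonempty, so the parent
is not itself inside L. -/
theorem jointCountIn_left (hm : 0 < m) (C : BalancedHierarchy n m) {L R : Finset (Fin n)}
    (hA : L ∪ R ∈ C.clusters) (hL : L ∈ C.clusters) (hR : R ∈ C.clusters) (hd : Disjoint L R)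
    {x y : Fin n} (hx : x ∈ L) (hy : y ∈ L) :
    C.jointCountIn (L ∪ R) x y = C.jointCountIn L x y + 1 := by
  obtain ⟨z, hz⟩ := Finset.card_pos.1 (hm.trans_le (C.le_card R hR))
  unfold jointCountIn
  rw [← Finset.card_insert_of_notMem (a := L ∪ R)]
  · congr 1
    ext B
    simp only [Finset.mem_filter, Finset.mem_insert]
    constructor
    · rintro ⟨hB, hBA, hxB, hyB⟩
      rcases C.subset_of_subset_union hL hR hB hBA with h2 | h2 | h2
      · exact Or.inl h2
      · exact Or.inr ⟨hB, h2, hxB, hyB⟩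
      · exact (Finset.disjoint_left.1 hd hx (h2 hxB)).elim
    · rintro (rfl | ⟨hB, hBL, h⟩)
      · exact ⟨hA, subset_rfl, Finset.mem_union_left _ hx, Finset.mem_union_left _ hy⟩
      · exact ⟨hB, hBL.trans Finset.subset_union_left, h⟩
  · rw [Finset.mem_filter]
    rintro ⟨-, h, -⟩
    exact Finset.disjoint_left.1 hd (h (Finset.mem_union_right _ hz)) hz

theorem jointCountIn_split (C : BalancedHierarchy n m) {L R : Finset (Fin n)}
    (hA : L ∪ R ∈ C.clusters) (hL : L ∈ C.clusters) (hR : R ∈ C.clusters) (hd : Disjoint L R)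
    {x y : Fin n} (hx : x ∈ L) (hy : y ∈ R) :
    C.jointCountIn (L ∪ R) x y = 1 := by
  refine Finset.card_eq_one.2 ⟨L ∪ R, ?_⟩
  ext B
  simp only [Finset.mem_filter, Finset.mem_singleton]
  constructor
  · rintro ⟨hB, hBA, hxB, hyB⟩
    rcases C.subset_of_subset_union hL hR hB hBA with h2 | h2 | h2
    · exact h2
    · exact (Finset.disjoint_left.1 hd (h2 hyB) hy).elim
    · exact (Finset.disjoint_left.1 hd hx (h2 hxB)).elim
  · rintro rfl
    exact ⟨hA, subset_rfl, Finset.mem_union_left _ hx, Finset.mem_union_right _ hy⟩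

/-- Two clusters of equal size carry isomorphic hierarchies. -/
theorem exists_injOn_jointCountIn (hm : 0 < m) (C C' : BalancedHierarchy n m) (k : ℕ) :
    ∀ A ∈ C.clusters, ∀ A' ∈ C'.clusters, A.card = k → A'.card = k →
      ∃ f : Fin n → Fin n, Set.InjOn f A ∧ Set.MapsTo f A A' ∧
        ∀ x ∈ A, ∀ y ∈ A, C'.jointCountIn A' (f x) (f y) = C.jointCountIn A x y := by
  induction k using Nat.strong_induction_on with
  | _ k ih =>
    intro A hA A' hA' hk hk'
    rcases le_or_gt k m with hkm | hkm
    -- Inside minimum clusters every count is 1, so any bijection works.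
    · let e : A ≃ A' := Finset.equivOfCardEq (hk.trans hk'.symm)
      refine ⟨fun x => if h : x ∈ A then e ⟨x, h⟩ else x, ?_, ?_, ?_⟩
      · intro x hx y hy hxy
        rw [Finset.mem_coe] at hx hy
        simp only [hx, hy, dif_pos] at hxy
        simpa using e.injective (Subtype.ext hxy)
      · intro x hx
        rw [Finset.mem_coe] at hx
        simp [hx]
      · intro x hx y hy
        simp only [hx, hy, dif_pos]
        rw [C.jointCountIn_of_card_le hA (hk.trans_le hkm) hx hy,
          C'.jointCountIn_of_card_le hA' (hk'.trans_le hkm) (e ⟨x, hx⟩).2 (e ⟨y, hy⟩).2]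
    · obtain ⟨L, hL, R, hR, hd, rfl, hc⟩ := C.split A hA (hk ▸ hkm)
      obtain ⟨L', hL', R', hR', hd', rfl, hc'⟩ := C'.split A' hA' (hk' ▸ hkm)
      rw [Finset.card_union_of_disjoint hd] at hk
      rw [Finset.card_union_of_disjoint hd'] at hk'
      obtain ⟨f, hf, hfm, hfc⟩ := ih L.card (by omega) L hL L' hL' rfl (by omega)
      obtain ⟨g, hg, hgm, hgc⟩ := ih R.card (by omega) R hR R' hR' rfl (by omega)
      have hnot : ∀ x ∈ R, x ∉ L := fun x hx h => Finset.disjoint_left.1 hd h hx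
      have hA2 : R ∪ L ∈ C.clusters := Finset.union_comm L R ▸ hA
      have hA2' : R' ∪ L' ∈ C'.clusters := Finset.union_comm L' R' ▸ hA'
      -- Glue the isomorphisms of the halves; pairs across the split have count 1 on both sides.
      refine ⟨fun x => if x ∈ L then f x else g x, ?_, ?_, ?_⟩
      · intro x hx y hy hxy
        simp only [Finset.coe_union, Set.mem_union, Finset.mem_coe] at hx hy
        rcases hx with hx | hx <;> rcases hy with hy | hy
        · simp only [hx, hy, if_true] at hxy
          exact hf hx hy hxy
        · simp only [hx, hnot y hy, if_true, if_false] at hxy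
          exact (Finset.disjoint_left.1 hd' (hfm hx) (hxy ▸ hgm hy)).elim
        · simp only [hy, hnot x hx, if_true, if_false] at hxy
          exact (Finset.disjoint_left.1 hd' (hfm hy) (hxy ▸ hgm hx)).elim
        · simp only [hnot x hx, hnot y hy, if_false] at hxy
          exact hg hx hy hxy
      · intro x hx
        simp only [Finset.coe_union, Set.mem_union, Finset.mem_coe] at hx ⊢
        rcases hx with hx | hx
        · simpa [hx] using Or.inl (hfm hx)
        · simpa [hnot x hx] using Or.inr (hgm hx)
      · intro x hx y hy
        rw [Finset.mem_union] at hx hy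
        rcases hx with hx | hx <;> rcases hy with hy | hy
        · simp only [hx, hy, if_true]
          rw [C.jointCountIn_left hm hA hL hR hd hx hy,
            C'.jointCountIn_left hm hA' hL' hR' hd' (hfm hx) (hfm hy), hfc x hx y hy]
        · simp only [hx, hnot y hy, if_true, if_false]
          rw [C.jointCountIn_split hA hL hR hd hx hy,
            C'.jointCountIn_split hA' hL' hR' hd' (hfm hx) (hgm hy)]
        · simp only [hy, hnot x hx, if_true, if_false]
          rw [jointCountIn_comm, C'.jointCountIn_split hA' hL' hR' hd' (hfm hy) (hgm hx),
            jointCountIn_comm, C.jointCountIn_split hA hL hR hd hy hx]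
        · simp only [hnot x hx, hnot y hy, if_false]
          rw [Finset.union_comm L R, Finset.union_comm L' R',
            C.jointCountIn_left hm hA2 hR hL hd.symm hx hy,
            C'.jointCountIn_left hm hA2' hR' hL' hd'.symm (hgm hx) (hgm hy), hgc x hx y hy]

/-- All hierarchies are relabellings of each other. -/
theorem exists_relabel_eq (hm : 0 < m) (C C' : BalancedHierarchy n m) :
    ∃ σ : Equiv.Perm (Fin n), C.relabel σ = C' := by
  obtain ⟨f, hf, -, hfc⟩ := exists_injOn_jointCountIn hm C C' _ _ C.univ_mem _ C'.univ_mem rfl rfl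
  have hinj : Function.Injective f := by simpa [Set.injOn_univ] using hf
  let σ : Equiv.Perm (Fin n) := Equiv.ofBijective f (Finite.injective_iff_bijective.1 hinj)
  refine ⟨σ, jointCount_injective hm (funext fun x => funext fun y => ?_)⟩
  have := hfc (σ.symm x) (Finset.mem_univ _) (σ.symm y) (Finset.mem_univ _)
  rw [jointCountIn_univ, jointCountIn_univ] at this
  rw [jointCount_relabel, ← this]
  have hσ : ∀ z, f (σ.symm z) = z := fun z => σ.apply_symm_apply z
  rw [hσ, hσ]

end BalancedHierarchy

/-! ### The dyadic hierarchy and its perturbations by transpositions -/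

namespace BalancedHierarchy

/-- The objects that agree with `q` after dropping the last `j` binary digits. -/
def dyadicBlock (N j q : ℕ) : Finset (Fin (2 ^ N)) :=
  Finset.univ.filter fun y => y.val / 2 ^ j = q

theorem mem_dyadicBlock {N j q : ℕ} {y : Fin (2 ^ N)} :
    y ∈ dyadicBlock N j q ↔ y.val / 2 ^ j = q := by
  simp [dyadicBlock]

theorem div_two_pow_lt {N j : ℕ} (hj : j ≤ N) (x : Fin (2 ^ N)) :
    x.val / 2 ^ j < 2 ^ (N - j) := by
  rw [Nat.div_lt_iff_lt_mul (by positivity), ← pow_add, Nat.sub_add_cancel hj]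
  exact x.2

theorem card_dyadicBlock {N j q : ℕ} (hj : j ≤ N) (hq : q < 2 ^ (N - j)) :
    (dyadicBlock N j q).card = 2 ^ j := by
  have hpos : 0 < 2 ^ j := by positivity
  have hle : (q + 1) * 2 ^ j ≤ 2 ^ N := by
    calc (q + 1) * 2 ^ j ≤ 2 ^ (N - j) * 2 ^ j := Nat.mul_le_mul_right _ hq
      _ = 2 ^ N := by rw [← pow_add, Nat.sub_add_cancel hj]
  rw [← Finset.card_map Fin.valEmbedding]
  have : (dyadicBlock N j q).map Fin.valEmbedding = Finset.Ico (q * 2 ^ j) ((q + 1) * 2 ^ j) := by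
    ext y
    simp only [Finset.mem_map, mem_dyadicBlock, Fin.valEmbedding_apply, Finset.mem_Ico]
    constructor
    · rintro ⟨x, hx, rfl⟩
      rw [Nat.div_eq_iff hpos] at hx
      rw [Nat.succ_mul]
      omega
    · rintro ⟨h1, h2⟩
      refine ⟨⟨y, h2.trans_le hle⟩, ?_, rfl⟩
      rw [Nat.div_eq_iff hpos]
      rw [Nat.succ_mul] at h2
      exact ⟨h1, by simp only; omega⟩
  rw [this, Nat.card_Ico, Nat.succ_mul]
  omega

theorem div_two_pow_eq_of_le {i j x y : ℕ} (hij : i ≤ j) (h : x / 2 ^ i = y / 2 ^ i) :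
    x / 2 ^ j = y / 2 ^ j := by
  rw [← Nat.add_sub_cancel' hij, pow_add, ← Nat.div_div_eq_div_mul, ← Nat.div_div_eq_div_mul, h]

theorem dyadicBlock_laminar {N i j p q : ℕ} (hij : i ≤ j) :
    dyadicBlock N i p ⊆ dyadicBlock N j q ∨ Disjoint (dyadicBlock N i p) (dyadicBlock N j q) := by
  by_cases h : Disjoint (dyadicBlock N i p) (dyadicBlock N j q)
  · exact Or.inr h
  · left
    obtain ⟨z, hz, hz'⟩ := Finset.not_disjoint_iff.1 h
    rw [mem_dyadicBlock] at hz hz'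
    intro y hy
    rw [mem_dyadicBlock] at hy ⊢
    rw [← hz']
    exact div_two_pow_eq_of_le hij (hy.trans hz.symm)

theorem dyadicBlock_succ (N j q : ℕ) :
    dyadicBlock N j (2 * q) ∪ dyadicBlock N j (2 * q + 1) = dyadicBlock N (j + 1) q := by
  ext y
  simp only [Finset.mem_union, mem_dyadicBlock, pow_succ, ← Nat.div_div_eq_div_mul]
  omega

/-- The hierarchy of the dyadic intervals of length at least `2 ^ a`. -/
def dyadic (N a : ℕ) (ha : a ≤ N) : BalancedHierarchy (2 ^ N) (2 ^ a) where
  clusters := (Finset.Icc a N ×ˢ (Finset.univ : Finset (Fin (2 ^ N)))).image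
    fun p => dyadicBlock N p.1 (p.2.val / 2 ^ p.1)
  univ_mem := by
    refine Finset.mem_image.2 ⟨(N, ⟨0, by positivity⟩), by simp [ha], ?_⟩
    ext y
    simp [mem_dyadicBlock, Nat.div_eq_of_lt y.2]
  le_card := by
    simp only [Finset.mem_image, Finset.mem_product, Finset.mem_Icc]
    rintro _ ⟨⟨j, x⟩, ⟨⟨hj, hj'⟩, -⟩, rfl⟩
    rw [card_dyadicBlock hj' (div_two_pow_lt hj' x)]
    exact Nat.pow_le_pow_right (by norm_num) hj
  laminar := by
    simp only [Finset.mem_image]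
    rintro _ ⟨⟨i, x⟩, -, rfl⟩ _ ⟨⟨j, y⟩, -, rfl⟩
    rcases le_total i j with h | h
    · rcases dyadicBlock_laminar (N := N) (p := x.val / 2 ^ i) (q := y.val / 2 ^ j) h with h | h
      · exact Or.inl h
      · exact Or.inr (Or.inr h)
    · rcases dyadicBlock_laminar (N := N) (p := y.val / 2 ^ j) (q := x.val / 2 ^ i) h with h | h
      · exact Or.inr (Or.inl h)
      · exact Or.inr (Or.inr h.symm)
  split := by
    simp only [Finset.mem_image, Finset.mem_product, Finset.mem_Icc]
    rintro _ ⟨⟨j, x⟩, ⟨⟨hj, hj'⟩, -⟩, rfl⟩ hlt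
    dsimp only at hj hj' hlt ⊢
    rw [card_dyadicBlock hj' (div_two_pow_lt hj' x)] at hlt
    obtain ⟨i, rfl⟩ : ∃ i, j = i + 1 :=
      ⟨j - 1, by have := (Nat.pow_lt_pow_iff_right (by norm_num : 1 < 2)).1 hlt; omega⟩
    have hai : a ≤ i := Nat.lt_succ_iff.1 ((Nat.pow_lt_pow_iff_right (by norm_num : 1 < 2)).1 hlt)
    set q := x.val / 2 ^ (i + 1) with hq
    have hqlt : q < 2 ^ (N - (i + 1)) := div_two_pow_lt hj' x
    have hN : 2 ^ (N - i) = 2 ^ (N - (i + 1)) * 2 := by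
      rw [← pow_succ]
      congr 1
      omega
    have hpow : 2 ^ N = 2 ^ (N - i) * 2 ^ i := by
      rw [← pow_add, Nat.sub_add_cancel (by omega)]
    have key : ∀ r, r < 2 ^ (N - i) → ∃ p : ℕ × Fin (2 ^ N),
        ((a ≤ p.1 ∧ p.1 ≤ N) ∧ p.2 ∈ Finset.univ) ∧
          dyadicBlock N p.1 (p.2.val / 2 ^ p.1) = dyadicBlock N i r := fun r hr =>
      ⟨(i, ⟨r * 2 ^ i, hpow ▸ Nat.mul_lt_mul_of_pos_right hr (by positivity)⟩),
        ⟨⟨hai, by dsimp only; omega⟩, Finset.mem_univ _⟩, by simp⟩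
    refine ⟨_, key (2 * q) (by omega), _, key (2 * q + 1) (by omega), ?_, dyadicBlock_succ N i q, ?_⟩
    · refine Finset.disjoint_left.2 fun y hy hy' => ?_
      rw [mem_dyadicBlock] at hy hy'
      omega
    · rw [card_dyadicBlock (by omega) (by omega), card_dyadicBlock (by omega) (by omega)]

/-- Each level has exactly one interval containing x, and intervals of different levels differ in
size, so common clusters correspond to levels. -/
theorem jointCount_dyadic {N a : ℕ} (ha : a ≤ N) (x y : Fin (2 ^ N)) :
    (dyadic N a ha).jointCount x y =
      ((Finset.Icc a N).filter fun j => x.val / 2 ^ j = y.val / 2 ^ j).card := by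
  refine (Finset.card_bij (fun j _ => dyadicBlock N j (x.val / 2 ^ j)) ?_ ?_ ?_).symm
  · intro j hj
    rw [Finset.mem_filter] at hj
    rw [Finset.mem_filter, mem_dyadicBlock, mem_dyadicBlock]
    exact ⟨Finset.mem_image.2 ⟨(j, x), by simpa using hj.1, rfl⟩, rfl, hj.2.symm⟩
  · intro i hi j hj h
    simp only [Finset.mem_filter, Finset.mem_Icc] at hi hj
    have := congrArg Finset.card h
    rw [card_dyadicBlock hi.1.2 (div_two_pow_lt hi.1.2 x),
      card_dyadicBlock hj.1.2 (div_two_pow_lt hj.1.2 x)] at this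
    exact Nat.pow_right_injective le_rfl this
  · intro A hA
    rw [Finset.mem_filter] at hA
    obtain ⟨hA, hx, hy⟩ := hA
    obtain ⟨⟨j, z⟩, hj, rfl⟩ := Finset.mem_image.1 hA
    rw [mem_dyadicBlock] at hx hy
    dsimp only at hx hy ⊢
    refine ⟨j, ?_, by rw [hx]⟩
    rw [Finset.mem_filter]
    exact ⟨(Finset.mem_product.1 hj).1, hx.trans hy.symm⟩

section Swap

variable {N a t : ℕ} {u v : Fin (2 ^ N)}

theorem swap_div_of_lt (huv : u.val / 2 ^ (t + 1) = v.val / 2 ^ (t + 1)) {j : ℕ} (hj : t < j)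
    (x : Fin (2 ^ N)) : (Equiv.swap u v x).val / 2 ^ j = x.val / 2 ^ j := by
  have h := div_two_pow_eq_of_le hj huv
  rcases eq_or_ne x u with rfl | hu
  · rw [Equiv.swap_apply_left, h]
  · rcases eq_or_ne x v with rfl | hv
    · rw [Equiv.swap_apply_right, h]
    · rw [Equiv.swap_apply_of_ne_of_ne hu hv]

/-- The cut at level t isolates what the transposition can change: when u and v share their interval
at level t + 1, levels above t are unaffected. -/
theorem jointCount_dyadic_eq_add (ha : a ≤ N) (x y : Fin (2 ^ N)) :
    (dyadic N a ha).jointCount x y =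
      ((Finset.Icc a N).filter fun j => j ≤ t ∧ x.val / 2 ^ j = y.val / 2 ^ j).card +
      ((Finset.Icc a N).filter fun j => t < j ∧ x.val / 2 ^ j = y.val / 2 ^ j).card := by
  rw [jointCount_dyadic, ← Finset.card_union_of_disjoint]
  · congr 1
    ext j
    simp only [Finset.mem_filter, Finset.mem_union]
    have := le_or_gt j t
    tauto
  · refine Finset.disjoint_left.2 fun j hj hj' => ?_
    rw [Finset.mem_filter] at hj hj'
    omega

theorem jointCount_swap_high (huv : u.val / 2 ^ (t + 1) = v.val / 2 ^ (t + 1))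
    (x y : Fin (2 ^ N)) :
    ((Finset.Icc a N).filter fun j => t < j ∧
      (Equiv.swap u v x).val / 2 ^ j = (Equiv.swap u v y).val / 2 ^ j).card =
    ((Finset.Icc a N).filter fun j => t < j ∧ x.val / 2 ^ j = y.val / 2 ^ j).card := by
  congr 1
  refine Finset.filter_congr fun j _ => and_congr_right fun hj => ?_
  rw [swap_div_of_lt huv hj, swap_div_of_lt huv hj]

/-- Only the levels a and a + 1 can be at most t, so at most two terms change. -/
theorem abs_jointCount_swap_sub_le (ha : a ≤ N) (hta : t ≤ a + 1)
    (huv : u.val / 2 ^ (t + 1) = v.val / 2 ^ (t + 1)) (x y : Fin (2 ^ N)) :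
    |((dyadic N a ha).jointCount (Equiv.swap u v x) (Equiv.swap u v y) : ℝ) -
      (dyadic N a ha).jointCount x y| ≤ 2 := by
  have hlow : ∀ x y : Fin (2 ^ N),
      ((Finset.Icc a N).filter fun j => j ≤ t ∧ x.val / 2 ^ j = y.val / 2 ^ j).card ≤ 2 := by
    intro x y
    calc _ ≤ (Finset.Icc a (a + 1)).card := by
          refine Finset.card_le_card fun j hj => ?_
          rw [Finset.mem_filter, Finset.mem_Icc] at hj
          rw [Finset.mem_Icc]
          omega
      _ = 2 := by
        rw [Nat.card_Icc]
        omega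
  rw [jointCount_dyadic_eq_add (t := t) ha, jointCount_dyadic_eq_add (t := t) ha x y,
    jointCount_swap_high huv]
  have key : ∀ p q r : ℕ, p ≤ 2 → q ≤ 2 → |((p + r : ℕ) : ℝ) - ((q + r : ℕ) : ℝ)| ≤ 2 := by
    intro p q r hp hq
    have hp' : (p : ℝ) ≤ 2 := by exact_mod_cast hp
    have hq' : (q : ℝ) ≤ 2 := by exact_mod_cast hq
    have hp0 : (0 : ℝ) ≤ p := p.cast_nonneg
    have hq0 : (0 : ℝ) ≤ q := q.cast_nonneg
    push_cast
    rw [abs_le]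
    constructor <;> linarith
  exact key _ _ _ (hlow _ _) (hlow _ _)

theorem jointCount_swap_of_div_ne (ha : a ≤ N)
    (huv : u.val / 2 ^ (t + 1) = v.val / 2 ^ (t + 1)) {x y : Fin (2 ^ N)}
    (hxy : x.val / 2 ^ (t + 1) ≠ y.val / 2 ^ (t + 1)) :
    (dyadic N a ha).jointCount (Equiv.swap u v x) (Equiv.swap u v y) =
      (dyadic N a ha).jointCount x y := by
  have hlow : ∀ x y : Fin (2 ^ N), x.val / 2 ^ (t + 1) ≠ y.val / 2 ^ (t + 1) →
      ((Finset.Icc a N).filter fun j => j ≤ t ∧ x.val / 2 ^ j = y.val / 2 ^ j).card = 0 := by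
    intro x y h
    rw [Finset.card_eq_zero, Finset.filter_eq_empty_iff]
    rintro j - ⟨hj, hj'⟩
    exact h (div_two_pow_eq_of_le (by omega) hj')
  rw [jointCount_dyadic_eq_add (t := t) ha, jointCount_dyadic_eq_add (t := t) ha x y,
    jointCount_swap_high huv, hlow x y hxy, hlow]
  rwa [swap_div_of_lt huv (by omega), swap_div_of_lt huv (by omega)]

/-- The squared distance between the similarities of the dyadic hierarchy and of the one in which
two nearby objects are exchanged. -/
theorem sum_sq_jointCount_swap_sub_le (ha : a ≤ N) (htN : t < N) (hta : t ≤ a + 1)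
    (huv : u.val / 2 ^ (t + 1) = v.val / 2 ^ (t + 1)) :
    ∑ p : Fin (2 ^ N) × Fin (2 ^ N),
      (((dyadic N a ha).jointCount (Equiv.swap u v p.1) (Equiv.swap u v p.2) : ℝ) -
        (dyadic N a ha).jointCount p.1 p.2) ^ 2 ≤ 64 * 2 ^ a := by
  set S : Finset (Fin (2 ^ N)) := {u, v}
  set D := dyadicBlock N (t + 1) (u.val / 2 ^ (t + 1))
  have hD : D.card = 2 ^ (t + 1) := card_dyadicBlock htN (div_two_pow_lt htN u)
  have hSD : S ⊆ D := by
    intro x hx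
    rcases Finset.mem_insert.1 hx with rfl | hx
    · exact mem_dyadicBlock.2 rfl
    · rw [Finset.mem_singleton.1 hx]
      exact mem_dyadicBlock.2 huv.symm
  have hS : S.card ≤ 2 := Finset.card_le_two
  -- A pair matters only if one entry is exchanged and the other lies in the enclosing interval D.
  -- There are at most 2 · 2 · 4 · 2 ^ a such pairs, each contributing at most 2².
  have hzero : ∀ p ∉ S ×ˢ D ∪ D ×ˢ S,
      (((dyadic N a ha).jointCount (Equiv.swap u v p.1) (Equiv.swap u v p.2) : ℝ) -
        (dyadic N a ha).jointCount p.1 p.2) ^ 2 = 0 := by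
    rintro ⟨x, y⟩ hp
    simp only [Finset.mem_union, Finset.mem_product, not_or, not_and] at hp
    have hfix : ∀ z ∉ S, Equiv.swap u v z = z := fun z hz => by
      simp only [S, Finset.mem_insert, Finset.mem_singleton, not_or] at hz
      exact Equiv.swap_apply_of_ne_of_ne hz.1 hz.2
    have heq : (dyadic N a ha).jointCount (Equiv.swap u v x) (Equiv.swap u v y) =
        (dyadic N a ha).jointCount x y := by
      by_cases hx : x ∈ S
      · refine jointCount_swap_of_div_ne ha huv fun h => hp.1 hx ?_
        rw [mem_dyadicBlock, ← h]
        exact mem_dyadicBlock.1 (hSD hx)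
      · by_cases hy : y ∈ S
        · refine jointCount_swap_of_div_ne ha huv fun h => hp.2 ?_ hy
          rw [mem_dyadicBlock, h]
          exact mem_dyadicBlock.1 (hSD hy)
        · rw [hfix x hx, hfix y hy]
    simp [heq]
  rw [← Finset.sum_subset (Finset.subset_univ (S ×ˢ D ∪ D ×ˢ S)) fun p _ hp => hzero p hp]
  have hcard : (S ×ˢ D ∪ D ×ˢ S).card ≤ 16 * 2 ^ a := by
    refine (Finset.card_union_le _ _).trans ?_
    rw [Finset.card_product, Finset.card_product, hD]
    have : 2 ^ (t + 1) ≤ 4 * 2 ^ a :=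
      calc 2 ^ (t + 1) ≤ 2 ^ (a + 2) := Nat.pow_le_pow_right (by norm_num) (by omega)
        _ = 4 * 2 ^ a := by ring
    nlinarith
  calc _ ≤ ∑ _p ∈ S ×ˢ D ∪ D ×ˢ S, (4 : ℝ) := by
        refine Finset.sum_le_sum fun p _ => ?_
        have := abs_jointCount_swap_sub_le ha hta huv p.1 p.2
        rw [← sq_abs]
        nlinarith [abs_nonneg (((dyadic N a ha).jointCount (Equiv.swap u v p.1)
          (Equiv.swap u v p.2) : ℝ) - (dyadic N a ha).jointCount p.1 p.2)]
    _ = (S ×ˢ D ∪ D ×ˢ S).card * 4 := by simp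
    _ ≤ (16 * 2 ^ a : ℕ) * 4 := by gcongr
    _ = 64 * 2 ^ a := by push_cast; ring

end Swap

/-- A family of alternatives to the dyadic hierarchy, each obtained by exchanging two objects. -/
theorem exists_swap_family (N a : ℕ) (ha : a < N) (hN : 2 ≤ N) :
    ∃ π : Fin (2 ^ (N - 1)) → Equiv.Perm (Fin (2 ^ N)),
      (Function.Injective fun i => (dyadic N a ha.le).relabel (π i)) ∧
      ∀ i, ∑ p : Fin (2 ^ N) × Fin (2 ^ N),
        ((((dyadic N a ha.le).relabel (π i)).jointCount p.1 p.2 : ℝ) -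
          (dyadic N a ha.le).jointCount p.1 p.2) ^ 2 ≤ 64 * 2 ^ a := by
  -- For a = 0 the level t = 0 would be useless: exchanging two sibling singletons leaves the
  -- hierarchy unchanged. Hence t = max a 1.
  obtain ⟨t, ht1, hat, hta, htN⟩ : ∃ t, 1 ≤ t ∧ a ≤ t ∧ t ≤ a + 1 ∧ t < N :=
    ⟨max a 1, by omega, by omega, by omega, by omega⟩
  set s := 2 ^ t with hs
  have hs2 : 2 ≤ s := by
    calc 2 = 2 ^ 1 := rfl
      _ ≤ 2 ^ t := Nat.pow_le_pow_right (by norm_num) ht1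
  have hs2' : 2 ^ (t + 1) = s * 2 := pow_succ _ _
  have hpow : 2 ^ N = 2 ^ (N - 1 - t) * (s * 2) := by
    rw [← hs2', ← pow_add]
    congr 1
    omega
  have hpow' : 2 ^ (N - 1) = 2 ^ (N - 1 - t) * s := by
    rw [hs, ← pow_add]
    congr 1
    omega
  have hq : ∀ i : Fin (2 ^ (N - 1)), i.val / s < 2 ^ (N - 1 - t) := fun i => by
    rw [Nat.div_lt_iff_lt_mul (by omega), ← hpow']
    exact i.2
  have hbound : ∀ i : Fin (2 ^ (N - 1)), ∀ r < s * 2, i.val / s * (s * 2) + r < 2 ^ N := by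
    intro i r hr
    rw [hpow]
    have := Nat.mul_le_mul_right (s * 2) (hq i)
    rw [Nat.succ_mul] at this
    omega
  have hmod : ∀ i : Fin (2 ^ (N - 1)), i.val % s < s := fun i => Nat.mod_lt _ (by omega)
  -- In each interval of length 2s, u is the first object, v runs through the right half, and w, the
  -- second object, is a witness that no exchange moves.
  let u : Fin (2 ^ (N - 1)) → Fin (2 ^ N) := fun i => ⟨i.val / s * (s * 2) + 0, hbound i 0 (by omega)⟩
  let w : Fin (2 ^ (N - 1)) → Fin (2 ^ N) := fun i => ⟨i.val / s * (s * 2) + 1, hbound i 1 (by omega)⟩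
  let v : Fin (2 ^ (N - 1)) → Fin (2 ^ N) := fun i =>
    ⟨i.val / s * (s * 2) + (s + i.val % s), hbound i _ (by have := hmod i; omega)⟩
  have hdiv : ∀ q r : ℕ, r < s * 2 → (q * (s * 2) + r) / (s * 2) = q := fun q r hr => by
    rw [mul_comm, Nat.mul_add_div (by omega), Nat.div_eq_of_lt hr, add_zero]
  have hmod2 : ∀ q r : ℕ, r < s * 2 → (q * (s * 2) + r) % (s * 2) = r := fun q r hr => by
    rw [mul_comm, Nat.mul_add_mod, Nat.mod_eq_of_lt hr]
  have huv : ∀ i, (u i).val / 2 ^ (t + 1) = (v i).val / 2 ^ (t + 1) := fun i => by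
    have := hmod i
    rw [hs2']
    simp only [u, v]
    rw [hdiv _ _ (by omega), hdiv _ _ (by omega)]
  have hum : ∀ i, (u i).val % (s * 2) = 0 := fun i => hmod2 _ _ (by omega)
  have hwm : ∀ i, (w i).val % (s * 2) = 1 := fun i => hmod2 _ _ (by omega)
  have hvm : ∀ i, (v i).val % (s * 2) = s + i.val % s := fun i =>
    hmod2 _ _ (by have := hmod i; omega)
  have hvinj : Function.Injective v := by
    intro i j hij
    have h1 := hvm i
    rw [hij, hvm j] at h1
    have h2 : (v i).val / (s * 2) = i.val / s := hdiv _ _ (by have := hmod i; omega)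
    have h3 : (v j).val / (s * 2) = j.val / s := hdiv _ _ (by have := hmod j; omega)
    rw [hij, h3] at h2
    refine Fin.ext ?_
    rw [← Nat.div_add_mod i.val s, ← Nat.div_add_mod j.val s, h2]
    omega
  have hne : ∀ {x y : Fin (2 ^ N)}, x.val % (s * 2) ≠ y.val % (s * 2) → x ≠ y := by
    rintro x y h rfl
    exact h rfl
  have hfixw : ∀ i j, Equiv.swap (u j) (v j) (w i) = w i := fun i j => by
    refine Equiv.swap_apply_of_ne_of_ne (hne ?_) (hne ?_)
    · rw [hwm, hum]; omega
    · rw [hwm, hvm]; omega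
  refine ⟨fun i => Equiv.swap (u i) (v i), ?_, fun i => ?_⟩
  · intro i j hij
    by_contra hcon
    -- Exchange i brings `v i` into the half containing `w i`; any other exchange fixes both objects
    -- and leaves them separated at level t.
    have h := congrArg (fun C : BalancedHierarchy (2 ^ N) (2 ^ a) => C.jointCount (w i) (v i)) hij
    simp only [jointCount_relabel, Equiv.symm_swap, hfixw, Equiv.swap_apply_right] at h
    rw [Equiv.swap_apply_of_ne_of_ne (hne (by rw [hum, hvm]; omega)) (hvinj.ne hcon),
      jointCount_dyadic, jointCount_dyadic] at h
    refine h.not_gt (Finset.card_lt_card ?_)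
    have hwu : (w i).val / s = (u i).val / s := by
      simp only [u, w]
      rw [mul_comm s 2, ← mul_assoc, mul_comm _ s, Nat.mul_add_div (by omega),
        Nat.mul_add_div (by omega), Nat.div_eq_of_lt (show 1 < s by omega), Nat.zero_div]
    have hvw : (w i).val / s ≠ (v i).val / s := by
      have := hmod i
      simp only [v, w]
      rw [mul_comm s 2, ← mul_assoc, mul_comm _ s, Nat.mul_add_div (by omega),
        Nat.mul_add_div (by omega), Nat.div_eq_of_lt (show 1 < s by omega),
        Nat.add_div_left _ (by omega), Nat.div_eq_of_lt this]
      omega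
    refine (Finset.ssubset_iff_of_subset fun k hk => ?_).2 ⟨t, ?_, ?_⟩
    · rw [Finset.mem_filter] at hk ⊢
      refine ⟨hk.1, ?_⟩
      rcases le_or_gt t k with h' | h'
      · exact div_two_pow_eq_of_le h' hwu
      · exact (hvw (div_two_pow_eq_of_le h'.le hk.2)).elim
    · exact Finset.mem_filter.2 ⟨Finset.mem_Icc.2 ⟨hat, htN.le⟩, hwu⟩
    · exact fun hk => hvw (Finset.mem_filter.1 hk).2
  · simp only [jointCount_relabel, Equiv.symm_swap]
    exact sum_sq_jointCount_swap_sub_le ha.le htN hta (huv i)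

end BalancedHierarchy

/-! ### Averaging over permutations -/

theorem Equiv.Perm.exists_apply_eq_apply_eq {α : Type*} {x y x' y' : α}
    (h : x ≠ y) (h' : x' ≠ y') : ∃ σ : Equiv.Perm α, σ x = x' ∧ σ y = y' := by
  classical
  refine ⟨(Equiv.swap x x').trans (Equiv.swap (Equiv.swap x x' y) y'), ?_, ?_⟩
  · rw [Equiv.trans_apply, Equiv.swap_apply_left, Equiv.swap_apply_of_ne_of_ne _ h']
    intro hx
    refine h ((Equiv.swap x x').injective ?_)
    rw [Equiv.swap_apply_left, ← hx]
  · simp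

/-- The average over all permutations of a function of two distinct points is the average of the
function. -/
theorem Equiv.Perm.sum_apply_apply {α : Type*} [Fintype α] [DecidableEq α] (g : α × α → ℝ)
    (hg : ∀ x, g (x, x) = 0) {x y : α} (hxy : x ≠ y) :
    ((Fintype.card α : ℝ) * (Fintype.card α - 1)) * ∑ σ : Equiv.Perm α, g (σ x, σ y) =
      (Fintype.card (Equiv.Perm α) : ℝ) * ∑ p, g p := by
  -- By double transitivity, right translation in the permutation group makes the sum independent of
  -- the off-diagonal pair; the double sum is then evaluated in both orders.
  have hconst : ∀ p ∈ (Finset.univ : Finset α).offDiag,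
      ∑ σ : Equiv.Perm α, g (σ p.1, σ p.2) = ∑ σ : Equiv.Perm α, g (σ x, σ y) := by
    intro p hp
    obtain ⟨ρ, h1, h2⟩ := Equiv.Perm.exists_apply_eq_apply_eq hxy (Finset.mem_offDiag.1 hp).2.2
    refine Fintype.sum_equiv (Equiv.mulRight ρ) _ _ fun σ => ?_
    simp [h1, h2]
  have hoff : ∀ σ : Equiv.Perm α,
      ∑ p ∈ (Finset.univ : Finset α).offDiag, g (σ p.1, σ p.2) = ∑ p, g p := by
    intro σ
    rw [← (Equiv.prodCongr σ σ).sum_comp]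
    refine Finset.sum_subset (Finset.subset_univ _) fun p _ hp => ?_
    have : p.1 = p.2 := by simpa using hp
    simp [this, hg]
  have hcard : (((Finset.univ : Finset α).offDiag.card : ℕ) : ℝ) =
      (Fintype.card α : ℝ) * (Fintype.card α - 1) := by
    rw [Finset.offDiag_card, Finset.card_univ, Nat.cast_sub (Nat.le_mul_self _)]
    push_cast
    ring
  have := Finset.sum_comm (s := (Finset.univ : Finset α).offDiag)
    (t := (Finset.univ : Finset (Equiv.Perm α))) (f := fun p σ => g (σ p.1, σ p.2))
  rw [Finset.sum_congr rfl hconst, Finset.sum_congr rfl fun σ _ => hoff σ] at this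
  rw [Finset.sum_const, Finset.sum_const, nsmul_eq_mul, nsmul_eq_mul, hcard, Finset.card_univ] at this
  exact this

/-- Some permutation makes a weighted sum over pairs at most its average. -/
theorem exists_perm_sum_le {α κ : Type*} [Fintype α] [Fintype κ] (b : α × α → ℝ)
    (hb : ∀ p, 0 ≤ b p) (g : κ → α × α → ℝ) (hg0 : ∀ i p, 0 ≤ g i p) (hg : ∀ i x, g i (x, x) = 0)
    {τ D : ℝ} (hτ : ∑ p, b p ≤ τ) (hD : ∀ i, ∑ p, g i p ≤ D) (hα : 2 ≤ Fintype.card α) :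
    ∃ σ : Equiv.Perm α, ∑ i, ∑ p : α × α, b p * g i (σ p.1, σ p.2) ≤
      Fintype.card κ * (2 * τ * D / (Fintype.card α : ℝ) ^ 2) := by
  classical
  set n : ℝ := (Fintype.card α : ℝ) with hn
  set F : ℝ := (Fintype.card (Equiv.Perm α) : ℝ)
  have hn2 : 2 ≤ n := by rw [hn]; exact_mod_cast hα
  have hF : 0 ≤ F := Nat.cast_nonneg _
  have hperm : ∀ i (p : α × α), ∑ σ : Equiv.Perm α, g i (σ p.1, σ p.2) ≤ F * (2 * D / n ^ 2) := by
    intro i p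
    have hG0 : 0 ≤ ∑ p, g i p := Finset.sum_nonneg fun p _ => hg0 i p
    have hD0 : 0 ≤ D := hG0.trans (hD i)
    rcases eq_or_ne p.1 p.2 with h | h
    · have : ∀ σ : Equiv.Perm α, g i (σ p.1, σ p.2) = 0 := fun σ => by rw [h, hg]
      simp only [this, Finset.sum_const_zero]
      positivity
    · have := Equiv.Perm.sum_apply_apply (g i) (hg i) h
      have hS : 0 ≤ ∑ σ : Equiv.Perm α, g i (σ p.1, σ p.2) :=
        Finset.sum_nonneg fun σ _ => hg0 i _
      rw [← mul_div_assoc, le_div_iff₀ (by positivity)]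
      have h1 : F * ∑ p, g i p ≤ F * D := mul_le_mul_of_nonneg_left (hD i) hF
      -- The factor 2 is the price of replacing n(n - 1) by n².
      have h2 : n ^ 2 ≤ 2 * (n * (n - 1)) := by nlinarith
      nlinarith [mul_le_mul_of_nonneg_right h2 hS]
  have hsum : ∑ σ : Equiv.Perm α, ∑ i, ∑ p : α × α, b p * g i (σ p.1, σ p.2) ≤
      ∑ _σ : Equiv.Perm α, Fintype.card κ * (2 * τ * D / n ^ 2) := by
    calc ∑ σ : Equiv.Perm α, ∑ i, ∑ p : α × α, b p * g i (σ p.1, σ p.2)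
        = ∑ i, ∑ p : α × α, b p * ∑ σ : Equiv.Perm α, g i (σ p.1, σ p.2) := by
          rw [Finset.sum_comm]
          refine Finset.sum_congr rfl fun i _ => ?_
          rw [Finset.sum_comm]
          simp_rw [Finset.mul_sum]
      _ ≤ ∑ _i : κ, F * (2 * τ * D / n ^ 2) := by
          refine Finset.sum_le_sum fun i _ => ?_
          have hD0 : 0 ≤ D := (Finset.sum_nonneg fun p _ => hg0 i p).trans (hD i)
          calc ∑ p : α × α, b p * ∑ σ : Equiv.Perm α, g i (σ p.1, σ p.2)
              ≤ ∑ p : α × α, b p * (F * (2 * D / n ^ 2)) :=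
                Finset.sum_le_sum fun p _ => mul_le_mul_of_nonneg_left (hperm i p) (hb p)
            _ = (∑ p, b p) * (F * (2 * D / n ^ 2)) := by rw [Finset.sum_mul]
            _ ≤ τ * (F * (2 * D / n ^ 2)) := by gcongr
            _ = F * (2 * τ * D / n ^ 2) := by ring
      _ = _ := by
          simp only [Finset.sum_const, Finset.card_univ, nsmul_eq_mul]
          ring
  obtain ⟨σ, -, hσ⟩ := Finset.exists_le_of_sum_le Finset.univ_nonempty hsum
  exact ⟨σ, hσ⟩

/-- A finite Markov inequality. -/
theorem three_mul_card_le_filter {κ : Type*} [Fintype κ] (f : κ → ℝ) (hf : ∀ i, 0 ≤ f i) {K : ℝ}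
    (hK : 0 < K) (h : ∑ i, f i ≤ Fintype.card κ * K) :
    3 * Fintype.card κ ≤ 4 * (Finset.univ.filter fun i => f i ≤ 4 * K).card := by
  have hsplit := Finset.card_filter_add_card_filter_not (s := (Finset.univ : Finset κ))
    (fun i => f i ≤ 4 * K)
  rw [Finset.card_univ] at hsplit
  have h1 : ((Finset.univ.filter fun i => ¬ f i ≤ 4 * K).card : ℝ) * (4 * K) ≤
      Fintype.card κ * K := by
    refine le_trans ?_ h
    calc _ = ∑ _i ∈ Finset.univ.filter fun i => ¬ f i ≤ 4 * K, 4 * K := by simp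
      _ ≤ ∑ i ∈ Finset.univ.filter fun i => ¬ f i ≤ 4 * K, f i :=
          Finset.sum_le_sum fun i hi => (not_le.1 (Finset.mem_filter.1 hi).2).le
      _ ≤ ∑ i, f i := Finset.sum_le_univ_sum_of_nonneg hf
  have h2 : (Finset.univ.filter fun i => ¬ f i ≤ 4 * K).card * 4 ≤ Fintype.card κ := by
    have : ((Finset.univ.filter fun i => ¬ f i ≤ 4 * K).card : ℝ) * 4 ≤ Fintype.card κ := by
      refine le_of_mul_le_mul_right ?_ hK
      linarith
    exact_mod_cast this
  omega

/-! ### The minimax lower bounds -/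

namespace NormalMeans

open BalancedHierarchy

/-- The second-moment bound with `n` hypotheses at logarithmic distance, in numbers. -/
theorem exp_div_add_le {n g K : ℝ} (hn : 4 ≤ n) (hg : n ≤ g ^ 2) (hg0 : 0 ≤ g)
    (hK : K ≤ Real.log n / 4) :
    ∃ t, 0 < t ∧ Real.exp K / (2 * t) + t / 2 / g ≤ 7 / 8 := by
  have hn0 : 0 < n := by linarith
  -- With q = n^(1/8) and t = q³, both terms are at most 1 / (2q), and n ≥ 4 exceeds (8/7)⁸.
  set q := Real.exp (Real.log n / 8) with hq
  have hq0 : 0 < q := Real.exp_pos _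
  have hpow : ∀ k : ℕ, q ^ k = Real.exp (k * (Real.log n / 8)) := fun k => by
    rw [hq, ← Real.exp_nat_mul]
  have hq8 : q ^ 8 = n := by
    rw [hpow]
    push_cast
    rw [mul_div_cancel₀ _ (by norm_num), Real.exp_log hn0]
  have hq78 : 8 / 7 ≤ q := by
    refine le_of_pow_le_pow_left₀ (n := 8) (by norm_num) hq0.le ?_
    rw [hq8]
    norm_num
    linarith
  have hK' : Real.exp K ≤ q ^ 2 := by
    rw [hpow]
    refine Real.exp_le_exp.2 ?_
    push_cast
    linarith
  have hg' : q ^ 4 ≤ g := by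
    refine le_of_sq_le_sq ?_ hg0
    rw [← pow_mul, hq8]
    exact hg
  refine ⟨q ^ 3, by positivity, ?_⟩
  calc Real.exp K / (2 * q ^ 3) + q ^ 3 / 2 / g
      ≤ q ^ 2 / (2 * q ^ 3) + q ^ 3 / 2 / q ^ 4 := by gcongr
    _ = 1 / q := by field_simp; norm_num
    _ ≤ 1 / (8 / 7) := by gcongr
    _ = 7 / 8 := by norm_num

/-- The constant is 512 = 4 · 2 · 64: Markov's inequality, the averaging over permutations, and the
distance of a transposition. -/
theorem le_budgetMinimaxRisk_cbmFamily {N a : ℕ} (ha : a < N) (hN : 2 ≤ N) {μ τ : ℝ} (hμ : 0 < μ)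
    (hτ : 0 < τ)
    (h : 512 * (μ ^ 2 * 2 ^ a * τ / (2 ^ N) ^ 2) ≤ Real.log (2 ^ N) / 4) :
    ENNReal.ofReal (1 / 8) ≤ budgetMinimaxRisk (cbmFamily (2 ^ N) (2 ^ a) μ) τ := by
  unfold budgetMinimaxRisk
  refine le_iInf fun B => le_iInf fun hB => le_iInf fun T => le_iInf fun hT => ?_
  obtain ⟨π, hπ, hdist⟩ := exists_swap_family N a ha hN
  set C₀ := dyadic N a ha.le
  set g : Fin (2 ^ (N - 1)) → Fin (2 ^ N) × Fin (2 ^ N) → ℝ := fun i p =>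
    (μ * ((C₀.relabel (π i)).jointCount p.1 p.2 : ℝ) - μ * (C₀.jointCount p.1 p.2 : ℝ)) ^ 2 with hgdef
  have hgsum : ∀ i, ∑ p, g i p ≤ μ ^ 2 * (64 * 2 ^ a) := fun i => by
    simp only [hgdef, ← mul_sub, mul_pow]
    rw [← Finset.mul_sum]
    exact mul_le_mul_of_nonneg_left (hdist i) (sq_nonneg _)
  have hdiag : ∀ i x, g i (x, x) = 0 := fun i x => by
    simp only [hgdef, C₀, jointCount_relabel, jointCount_dyadic]
    simp
  have hM : 2 ^ N = 2 * 2 ^ (N - 1) := by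
    rw [← pow_succ']
    congr 1
    omega
  obtain ⟨σ, hσ⟩ := exists_perm_sum_le (fun p => (B p : ℝ)) (fun p => (B p).coe_nonneg) g
    (fun i p => sq_nonneg _) hdiag hB hgsum (by
      rw [Fintype.card_fin]
      calc 2 = 2 ^ 1 := rfl
        _ ≤ 2 ^ N := Nat.pow_le_pow_right (by norm_num) (by omega))
  set K : ℝ := 2 * τ * (μ ^ 2 * (64 * 2 ^ a)) / ((Fintype.card (Fin (2 ^ N)) : ℕ) : ℝ) ^ 2 with hKdef
  have hK0 : 0 < K := by
    rw [hKdef, Fintype.card_fin]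
    positivity
  have hK4 : 4 * K ≤ Real.log (2 ^ N) / 4 := by
    refine le_trans (le_of_eq ?_) h
    rw [hKdef, Fintype.card_fin]
    push_cast
    ring
  set G₀ := Finset.univ.filter fun i =>
    ∑ p : Fin (2 ^ N) × Fin (2 ^ N), (B p : ℝ) * g i (σ p.1, σ p.2) ≤ 4 * K with hG₀
  have hcard : 3 * 2 ^ (N - 1) ≤ 4 * G₀.card := by
    have := three_mul_card_le_filter _ (fun i => Finset.sum_nonneg fun p _ =>
      mul_nonneg (B p).coe_nonneg (sq_nonneg _)) hK0 hσ
    rwa [Fintype.card_fin] at this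
  have hsq : 2 ^ N ≤ G₀.card ^ 2 := by
    rw [hM]
    rcases hN.eq_or_lt with rfl | hN3
    · norm_num at hcard ⊢
      nlinarith [show 2 ≤ G₀.card by omega]
    · have : 4 ≤ 2 ^ (N - 1) :=
        calc 4 = 2 ^ 2 := rfl
          _ ≤ 2 ^ (N - 1) := Nat.pow_le_pow_right (by norm_num) (by omega)
      nlinarith
  -- The centre and all alternatives are renamed together, so their weighted distances under B are
  -- those controlled by the choice of σ.
  have hinj : Function.Injective fun i => (C₀.relabel (π i)).relabel σ.symm :=
    (relabel_injective (by positivity) σ.symm).comp hπ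
  set G := G₀.map ⟨_, hinj⟩ with hG
  have hGc : G.card = G₀.card := Finset.card_map _
  have hn4 : (4 : ℝ) ≤ 2 ^ N :=
    calc (4 : ℝ) = 2 ^ 2 := by norm_num
      _ ≤ 2 ^ N := pow_le_pow_right₀ (by norm_num) hN
  obtain ⟨t, ht, hle⟩ := exp_div_add_le (g := G.card) hn4 (by rw [hGc]; exact_mod_cast hsq)
    (Nat.cast_nonneg _) hK4
  have hGne : G.Nonempty := by
    rw [← Finset.card_pos, hGc]
    have : 0 < 2 ^ (N - 1) := by positivity
    omega
  have := le_maxRisk_designLaw (cbmFamily (2 ^ N) (2 ^ a) μ)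
    (cbmFamily (2 ^ N) (2 ^ a) μ (C₀.relabel σ.symm)) B hGne ht ?_ hle hT
  · norm_num at this ⊢
    exact this
  · intro C hC
    rw [hG, Finset.mem_map] at hC
    obtain ⟨i, hi, rfl⟩ := hC
    refine le_trans (le_of_eq ?_) (Finset.mem_filter.1 hi).2
    simp [hgdef, cbmFamily_apply, jointCount_relabel _ σ.symm]

theorem budgetMinimaxRisk_le_minimaxRisk {ι J : Type*} [Fintype ι] (v : J → ι → ℝ) {τ : ℝ}
    (hτ : Fintype.card ι ≤ τ) : budgetMinimaxRisk v τ ≤ minimaxRisk v := by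
  have hlaw : isotropicLaw v = designLaw v 1 := funext fun j => isotropicLaw_eq_designLaw v j
  unfold budgetMinimaxRisk minimaxRisk
  rw [hlaw]
  exact iInf₂_le 1 (by simpa using hτ)

/-- The lower bound in the experimental design setting, along sequences. -/
theorem eventually_le_budgetMinimaxRisk {n m : ℕ → ℕ} {μ τ : ℕ → ℝ} (hn : ∀ k, ∃ i, n k = 2 ^ i)
    (hm : ∀ k, ∃ i, m k = 2 ^ i) (hmn : ∀ k, m k < n k) (hn2 : ∀ k, 2 < n k) (hμ : ∀ k, 0 < μ k)
    (hτ : ∀ k, 0 < τ k)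
    (h : μ =o[atTop] fun k =>
      √((n k : ℝ) ^ 2 * Real.log ((n k : ℝ) * (m k : ℝ)) / ((m k : ℝ) * τ k))) :
    ∀ᶠ k in atTop, ENNReal.ofReal (1 / 8) ≤
      budgetMinimaxRisk (cbmFamily (n k) (m k) (μ k)) (τ k) := by
  -- Since log(nm) ≤ 2 log n, the constant 1/64 gives 512 · (1/64)² · 2 = 1/4.
  filter_upwards [h.def (c := 1 / 64) (by norm_num)] with k hk
  specialize hn k
  specialize hm k
  specialize hmn k
  specialize hn2 k
  specialize hμ k
  specialize hτ k
  generalize n k = n at *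
  generalize m k = m at *
  generalize μ k = μ at *
  generalize τ k = τ at *
  obtain ⟨N, rfl⟩ := hn
  obtain ⟨a, rfl⟩ := hm
  have haN : a < N := (Nat.pow_lt_pow_iff_right (by norm_num)).1 hmn
  have hN : 2 ≤ N := by
    by_contra hcon
    have : 2 ^ N ≤ 2 ^ 1 := Nat.pow_le_pow_right (by norm_num) (by omega)
    omega
  refine le_budgetMinimaxRisk_cbmFamily haN hN hμ hτ ?_
  rw [Real.norm_of_nonneg hμ.le, Real.norm_of_nonneg (Real.sqrt_nonneg _)] at hk
  push_cast at hk
  have hlog : Real.log ((2 : ℝ) ^ N * 2 ^ a) ≤ 2 * Real.log (2 ^ N) := by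
    rw [Real.log_mul (by positivity) (by positivity)]
    have : Real.log ((2 : ℝ) ^ a) ≤ Real.log (2 ^ N) :=
      Real.log_le_log (by positivity) (pow_le_pow_right₀ (by norm_num) haN.le)
    linarith
  have hlog0 : 0 ≤ Real.log ((2 : ℝ) ^ N * 2 ^ a) :=
    Real.log_nonneg (one_le_mul_of_one_le_of_one_le (one_le_pow₀ (by norm_num))
      (one_le_pow₀ (by norm_num)))
  have hsq := pow_le_pow_left₀ hμ.le hk 2
  rw [mul_pow, Real.sq_sqrt (by positivity)] at hsq
  have hx : μ ^ 2 * 2 ^ a * τ / (2 ^ N) ^ 2 ≤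
      (1 / 64) ^ 2 * Real.log ((2 : ℝ) ^ N * 2 ^ a) := by
    rw [div_le_iff₀ (by positivity)]
    calc μ ^ 2 * 2 ^ a * τ = μ ^ 2 * (2 ^ a * τ) := by ring
      _ ≤ _ * (2 ^ a * τ) := mul_le_mul_of_nonneg_right hsq (by positivity)
      _ = _ := by field_simp
  linarith

end NormalMeans

/-! ### Minimax optimality of maximum likelihood under transitive symmetry -/

namespace NormalMeans

variable {ι J : Type*} [Fintype ι]

/-- A maximum likelihood estimator of a finite family exists. -/
theorem exists_isMLE [Finite J] [Nonempty J] (v : J → ι → ℝ) : ∃ T, IsMLE v T := by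
  classical
  have := Fintype.ofFinite J
  suffices h : ∀ s : Finset J, s.Nonempty →
      ∃ T : (ι → ℝ) → J, IsEstimator T ∧ ∀ y, ∀ j ∈ s, likelihood v j y ≤ likelihood v (T y) y by
    obtain ⟨T, hT, hmax⟩ := h Finset.univ Finset.univ_nonempty
    exact ⟨T, hT, fun y j => hmax y j (Finset.mem_univ j)⟩
  intro s hs
  induction hs using Finset.Nonempty.cons_induction with
  | singleton a =>
    refine ⟨fun _ => a, fun s => MeasurableSet.const (a ∈ s), fun y j hj => ?_⟩
    rw [Finset.mem_singleton.1 hj]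
  | cons a s ha hs ih =>
    obtain ⟨T, hT, hmax⟩ := ih
    -- Adding one hypothesis at a time keeps the maximizer measurable: the comparison set splits
    -- over the finitely many values of T.
    have hmeas : MeasurableSet {y | likelihood v (T y) y ≤ likelihood v a y} := by
      have : {y | likelihood v (T y) y ≤ likelihood v a y} =
          ⋃ j, T ⁻¹' {j} ∩ {y | likelihood v j y ≤ likelihood v a y} := by
        ext y
        simp
      rw [this]
      exact MeasurableSet.iUnion fun j => (hT {j}).inter
        (measurableSet_le (measurable_likelihood v j) (measurable_likelihood v a))
    refine ⟨fun y => if likelihood v (T y) y ≤ likelihood v a y then a else T y, ?_, ?_⟩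
    · intro s
      have : (fun y => if likelihood v (T y) y ≤ likelihood v a y then a else T y) ⁻¹' s =
          {y | likelihood v (T y) y ≤ likelihood v a y}.ite {_y | a ∈ s} (T ⁻¹' s) := by
        ext y
        by_cases hy : likelihood v (T y) y ≤ likelihood v a y <;> simp [Set.ite, hy]
      rw [this]
      exact hmeas.ite (MeasurableSet.const _) (hT s)
    · intro y j hj
      rw [Finset.mem_cons] at hj
      dsimp only
      split_ifs with hy
      · rcases hj with rfl | hj
        · exact le_rfl
        · exact (hmax y j hj).trans hy
      · rcases hj with rfl | hj
        · exact (not_le.1 hy).le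
        · exact hmax y j hj

theorem likelihood_eq_mul_exp (v : J → ι → ℝ) (j : J) (y : ι → ℝ) :
    likelihood v j y =
      (√(2 * Real.pi))⁻¹ ^ Fintype.card ι * Real.exp (∑ i, -(y i - v j i) ^ 2 / 2) := by
  simp [likelihood, gaussianPDFReal_def, Finset.prod_mul_distrib, Real.exp_sum]

/-- Ties between distinct hypotheses have measure zero. -/
theorem volume_likelihood_eq (v : J → ι → ℝ) {j k : J} (h : v j ≠ v k) :
    volume {y | likelihood v j y = likelihood v k y} = 0 := by
  -- The covariances agree, so the quadratic terms in y cancel and ties satisfy an affine equation.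
  let ℓ : (ι → ℝ) →ₗ[ℝ] ℝ := ∑ i, (v j i - v k i) • LinearMap.proj i
  have hℓ : ∀ y, ℓ y = ∑ i, (v j i - v k i) * y i := fun y => by simp [ℓ]
  set b : ℝ := ∑ i, (v j i ^ 2 - v k i ^ 2) / 2
  let S : AffineSubspace ℝ (ι → ℝ) := (AffineSubspace.mk' b ⊥).comap ℓ.toAffineMap
  have hS : ∀ y, y ∈ S ↔ ℓ y = b := fun y => by
    simp [S, AffineSubspace.mem_comap, AffineSubspace.mem_mk', sub_eq_zero]
  refine measure_mono_null (t := (S : Set (ι → ℝ))) (fun y hy => ?_)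
    (Measure.addHaar_affineSubspace _ S fun htop => ?_)
  · change likelihood v j y = likelihood v k y at hy
    rw [likelihood_eq_mul_exp, likelihood_eq_mul_exp,
      mul_right_inj' (by positivity), Real.exp_eq_exp, ← sub_eq_zero,
      ← Finset.sum_sub_distrib] at hy
    rw [SetLike.mem_coe, hS, hℓ, ← sub_eq_zero, ← Finset.sum_sub_distrib, ← hy]
    exact Finset.sum_congr rfl fun i _ => by ring
  -- If the equation held everywhere, testing it at 0 and at `v j - v k` would give ‖v j - v k‖² =
  -- 0.
  · have h0 := (hS 0).1 (htop ▸ AffineSubspace.mem_top _ _ _)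
    have h1 := (hS (v j - v k)).1 (htop ▸ AffineSubspace.mem_top _ _ _)
    rw [map_zero] at h0
    simp only [← h0, hℓ, Pi.sub_apply] at h1
    rw [Finset.sum_eq_zero_iff_of_nonneg fun i _ => mul_self_nonneg _] at h1
    exact h (funext fun i => sub_eq_zero.1 (mul_self_eq_zero.1 (h1 i (Finset.mem_univ i))))

/-- The observations at which some other hypothesis is at least as likely as `j`. -/
def confusionSet (v : J → ι → ℝ) (j : J) : Set (ι → ℝ) :=
  {y | ∃ k, k ≠ j ∧ likelihood v j y ≤ likelihood v k y}

/-- Arbitrary tie-breaking need not respect the symmetries. Replacing the error event by one that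
does not mention T, at the cost of a null set, restores invariance. -/
theorem isotropicLaw_isMLE_ne [Countable J] {v : J → ι → ℝ} (hv : Function.Injective v)
    {T : (ι → ℝ) → J} (hT : IsMLE v T) (j : J) :
    isotropicLaw v j {y | T y ≠ j} = isotropicLaw v j (confusionSet v j) := by
  refine le_antisymm (measure_mono fun y hy => ⟨T y, hy, hT.2 y j⟩) ?_
  have hsub : confusionSet v j ⊆
      {y | T y ≠ j} ∪ ⋃ k : {k // k ≠ j}, {y | likelihood v j y = likelihood v k y} := by
    rintro y ⟨k, hk, hle⟩
    by_cases hy : T y = j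
    · exact Or.inr (Set.mem_iUnion.2 ⟨⟨k, hk⟩, hle.antisymm (hy ▸ hT.2 y k)⟩)
    · exact Or.inl hy
  have hnull : isotropicLaw v j
      (⋃ k : {k // k ≠ j}, {y | likelihood v j y = likelihood v k y}) = 0 :=
    measure_iUnion_null fun k => isotropicLaw_absolutelyContinuous v j
      (volume_likelihood_eq v (hv.ne k.2.symm))
  calc _ ≤ _ := measure_mono hsub
    _ ≤ _ := measure_union_le _ _
    _ = _ := by rw [hnull, add_zero]

theorem isotropicLaw_confusionSet_eq (v : J → ι → ℝ) (e : Equiv.Perm ι) (s : Equiv.Perm J)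
    (hes : ∀ i p, v (s i) (e p) = v i p) (j : J) :
    isotropicLaw v (s j) (confusionSet v (s j)) = isotropicLaw v j (confusionSet v j) := by
  set φ := MeasurableEquiv.piCongrLeft (fun _ : ι => ℝ) e
  have hφ : ∀ y p, φ y (e p) = y p := fun y p =>
    Equiv.piCongrLeft_apply_apply (fun _ : ι => ℝ) e y p
  have hmp := measurePreserving_piCongrLeft (fun p => gaussianReal (v (s j) p) 1) e
  simp only [hes] at hmp
  have hL : ∀ i y, likelihood v (s i) (φ y) = likelihood v i y := fun i y => by
    unfold likelihood
    rw [← Equiv.prod_comp e]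
    simp only [hes, hφ]
  have hset : φ ⁻¹' confusionSet v (s j) = confusionSet v j := by
    ext y
    constructor
    · rintro ⟨k, hk, hle⟩
      refine ⟨s.symm k, fun h => hk (by rw [← h, Equiv.apply_symm_apply]), ?_⟩
      rw [← hL j, ← hL (s.symm k), Equiv.apply_symm_apply]
      exact hle
    · rintro ⟨k, hk, hle⟩
      exact ⟨s k, s.injective.ne hk, by rwa [hL, hL]⟩
  rw [← hset]
  exact (hmp.measure_preimage_equiv _).symm

/-- Among all estimators, a maximum likelihood estimator has the largest average probability of
being correct. -/
theorem sum_isotropicLaw_le_of_isMLE [Fintype J] {v : J → ι → ℝ} {T T' : (ι → ℝ) → J}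
    (hT : IsMLE v T) (hT' : IsEstimator T') :
    ∑ j, isotropicLaw v j (T' ⁻¹' {j}) ≤ ∑ j, isotropicLaw v j (T ⁻¹' {j}) := by
  classical
  -- The total success probability is the integral of the likelihood of the selected hypothesis,
  -- which maximum likelihood maximizes pointwise.
  have key : ∀ S : (ι → ℝ) → J, IsEstimator S →
      ∑ j, isotropicLaw v j (S ⁻¹' {j}) = ∫⁻ y, ENNReal.ofReal (likelihood v (S y) y) := by
    intro S hS
    have h1 : ∀ j, isotropicLaw v j (S ⁻¹' {j}) =
        ∫⁻ y, (S ⁻¹' {j}).indicator (fun y => ENNReal.ofReal (likelihood v j y)) y := fun j => by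
      rw [isotropicLaw_eq_withDensity, withDensity_apply _ (hS _), lintegral_indicator (hS _)]
    simp_rw [h1]
    rw [← lintegral_finsetSum _ fun j _ =>
      (measurable_likelihood v j).ennreal_ofReal.indicator (hS _)]
    refine lintegral_congr fun y => ?_
    simp [Set.indicator_apply]
  rw [key T hT.1, key T' hT']
  exact lintegral_mono fun y => ENNReal.ofReal_le_ofReal (hT.2 y (T' y))

/-- If the hypotheses are permuted transitively by symmetries of the coordinates, then every maximum
likelihood estimator is minimax. -/
theorem maxRisk_eq_minimaxRisk_of_isMLE [Finite J] {v : J → ι → ℝ} (hv : Function.Injective v)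
    (hsymm : ∀ j k, ∃ (e : Equiv.Perm ι) (s : Equiv.Perm J),
      s j = k ∧ ∀ i p, v (s i) (e p) = v i p)
    {T : (ι → ℝ) → J} (hT : IsMLE v T) :
    maxRisk (isotropicLaw v) T = minimaxRisk v := by
  have := Fintype.ofFinite J
  refine le_antisymm (le_iInf₂ fun T' hT' => iSup_le fun j₀ => ?_) (iInf₂_le T hT.1)
  have hconst : ∀ j, isotropicLaw v j {y | T y ≠ j} = isotropicLaw v j₀ {y | T y ≠ j₀} := by
    intro j
    obtain ⟨e, s, rfl, hes⟩ := hsymm j₀ j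
    rw [isotropicLaw_isMLE_ne hv hT, isotropicLaw_isMLE_ne hv hT,
      isotropicLaw_confusionSet_eq v e s hes]
  have hcompl : ∀ S : (ι → ℝ) → J, IsEstimator S → ∀ j,
      (isotropicLaw v j).real {y | S y ≠ j} = 1 - (isotropicLaw v j).real (S ⁻¹' {j}) := by
    intro S hS j
    rw [← probReal_compl_eq_one_sub (hS {j})]
    rfl
  have hsum : ∑ j, (isotropicLaw v j).real {y | T y ≠ j} ≤
      ∑ j, (isotropicLaw v j).real {y | T' y ≠ j} := by
    simp_rw [hcompl T hT.1, hcompl T' hT', Finset.sum_sub_distrib]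
    refine sub_le_sub_left ?_ _
    simp only [Measure.real]
    rw [← ENNReal.toReal_sum fun j _ => measure_ne_top _ _,
      ← ENNReal.toReal_sum fun j _ => measure_ne_top _ _]
    exact ENNReal.toReal_mono (ENNReal.sum_ne_top.2 fun j _ => measure_ne_top _ _)
      (sum_isotropicLaw_le_of_isMLE hT hT')
  -- Comparing averages gives a hypothesis where T' errs at least as often as T, whose error there
  -- equals its error at `j₀`.
  obtain ⟨j, -, hj⟩ := Finset.exists_le_of_sum_le ⟨j₀, Finset.mem_univ j₀⟩ hsum
  refine le_trans ?_ (le_iSup _ j)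
  rw [← hconst j]
  exact (ENNReal.toReal_le_toReal (measure_ne_top _ _) (measure_ne_top _ _)).1 hj

end NormalMeans

/-! ### Symmetries of the block model and the conclusion -/

namespace BalancedHierarchy

/-- Renaming the objects, as a permutation of the hierarchies. -/
noncomputable def relabelPerm {n m : ℕ} (hm : 0 < m) (σ : Equiv.Perm (Fin n)) :
    Equiv.Perm (BalancedHierarchy n m) :=
  Equiv.ofBijective _ (Finite.injective_iff_bijective.1 (relabel_injective hm σ))

theorem exists_symmetry_cbmFamily {n m : ℕ} (hm : 0 < m) (μ : ℝ) (C C' : BalancedHierarchy n m) :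
    ∃ (e : Equiv.Perm (Fin n × Fin n)) (s : Equiv.Perm (BalancedHierarchy n m)),
      s C = C' ∧ ∀ D p, cbmFamily n m μ (s D) (e p) = cbmFamily n m μ D p := by
  obtain ⟨σ, hσ⟩ := exists_relabel_eq hm C C'
  refine ⟨Equiv.prodCongr σ σ, relabelPerm hm σ, hσ, fun D p => ?_⟩
  simp [cbmFamily_apply, relabelPerm, jointCount_relabel]

end BalancedHierarchy

theorem corollary3 :
    (∃ c : ℝ≥0∞, 0 < c ∧
      ∀ (n m : ℕ → ℕ) (μ : ℕ → ℝ),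
        (∀ k, ∃ i, n k = 2 ^ i) → (∀ k, ∃ i, m k = 2 ^ i) →
        (∀ k, m k < n k) → (∀ k, 2 < n k) → (∀ k, 0 < μ k) →
        ((μ =o[atTop] fun k => √(Real.log ((n k : ℝ) * (m k : ℝ)) / (m k : ℝ))) →
          ∀ᶠ k in atTop, c ≤ NormalMeans.minimaxRisk (cbmFamily (n k) (m k) (μ k))) ∧
        (∀ τ : ℕ → ℝ, (∀ k, 0 < τ k) →
          (μ =o[atTop] fun k =>
            √((n k : ℝ) ^ 2 * Real.log ((n k : ℝ) * (m k : ℝ)) / ((m k : ℝ) * τ k))) →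
          ∀ᶠ k in atTop,
            c ≤ NormalMeans.budgetMinimaxRisk (cbmFamily (n k) (m k) (μ k)) (τ k))) ∧
    (∀ (n m : ℕ) (μ : ℝ),
      (∃ i, n = 2 ^ i) → (∃ i, m = 2 ^ i) → m ≤ n → 0 < μ →
        (∃ T, NormalMeans.IsMLE (cbmFamily n m μ) T) ∧
        ∀ T, NormalMeans.IsMLE (cbmFamily n m μ) T →
          NormalMeans.maxRisk (NormalMeans.isotropicLaw (cbmFamily n m μ)) T =
            NormalMeans.minimaxRisk (cbmFamily n m μ)) := by
  refine ⟨⟨ENNReal.ofReal (1 / 8), by norm_num, ?_⟩, ?_⟩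
  · intro n m μ hn hm hmn hn2 hμ
    have hbudget := fun τ hτ h =>
      NormalMeans.eventually_le_budgetMinimaxRisk (τ := τ) hn hm hmn hn2 hμ hτ h
    refine ⟨fun h => ?_, hbudget⟩
    have hn0 : ∀ k, 0 < (n k : ℝ) := fun k => by exact_mod_cast (by omega : 0 < 2).trans (hn2 k)
    -- Unit precision on all n² coordinates is admissible at τ = n², where the two signal conditions
    -- coincide.
    refine (hbudget (fun k => (n k : ℝ) ^ 2) (fun k => by have := hn0 k; positivity) ?_).mono
      fun k hk => hk.trans (NormalMeans.budgetMinimaxRisk_le_minimaxRisk _ ?_)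
    · refine h.congr_right fun k => ?_
      rw [mul_comm (m k : ℝ), mul_div_mul_left _ _ (pow_ne_zero 2 (hn0 k).ne')]
    · simp [sq]
  · rintro _ _ μ ⟨N, rfl⟩ ⟨a, rfl⟩ hle hμ
    have ha : a ≤ N := (Nat.pow_le_pow_iff_right (by norm_num)).1 hle
    have hm : 0 < 2 ^ a := by positivity
    have : Nonempty (BalancedHierarchy (2 ^ N) (2 ^ a)) := ⟨BalancedHierarchy.dyadic N a ha⟩
    exact ⟨NormalMeans.exists_isMLE _, fun T hT => NormalMeans.maxRisk_eq_minimaxRisk_of_isMLE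
      (BalancedHierarchy.cbmFamily_injective hm hμ.ne')
      (BalancedHierarchy.exists_symmetry_cbmFamily hm μ) hT⟩
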